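/- For $k\in\mathbb N$ let $W_k=\{x\in\mathbb R^k: x_1\ge\dots\ge x_k\}$, $W_k^\circ=\{x\in\mathbb R^k: x_1>\dots>x_k\}$ and $\mathfrak W_k=W_k\cap\mathbb Z^k$. For $T\in\mathbb N$ and $x,y\in\mathfrak W_k$ let $\mathbb P^{0,T,x,y}_{avoid,Ber}$ denote the law of $k$ independent Bernoulli bridges $B_1,\dots,B_k$, where $B_i$ is uniformly distributed on the set of up-right paths $\{0,\dots,T\}\to\mathbb Z$ (all increments in $\{0,1\}$) from $B_i(0)=x_i$ to $B_i(T)=y_i$, conditioned on $B_1(r)\ge B_2(r)\ge\dots\ge B_k(r)$ for all $r\in\{0,\dots,T\}$; equivalently, this is the uniform distribution on the set of such non-crossing collections of paths, and it is defined when this set is non-empty. Paths are extended to $[0,T]$ by linear interpolation. Fix $p,t\in(0,1)$ and $a,b\in W_k$, and put $$c_1=\frac1{p(1-p)t},\qquad c_2=\frac1{p(1-p)(1-t)},\qquad c_3=\frac1{2p(1-p)t(1-t)}.$$ For $c>0$, $z\in\mathbb R^k$ and $a=(\underbrace{\alpha_1,\dots,\alpha_1}_{m_1},\dots,\underbrace{\alpha_q,\dots,\alpha_q}_{m_q})$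 with $\alpha_1>\dots>\alpha_q$, let $D_c(a,z)$ be the determinant of the $k\times k$ matrix whose rows are, from top to bottom, $$\big((cz_j)^{r-1}e^{c\alpha_l z_j}\big)_{j=1,\dots,k},\qquad l=1,\dots,q,\quad r=1,\dots,m_l .$$ Let $\varphi(a,z)=D_{c_1}(a,z)$, $\psi(b,z)=D_{c_2}(b,z)$ and $$H(z)=\varphi(a,z)\,\psi(b,z)\prod_{i=1}^k e^{-c_3z_i^2},\qquad Z_c=\int_{W_k}H(z)\,dz,\qquad \rho(z)=Z_c^{-1}\,\mathbf 1_{\{z_1>\dots>z_k\}}\,H(z).$$ Let $x^T,y^T\in\mathfrak W_k$, $T\in\mathbb N$, be such that for all $i=1,\dots,k$ $$\lim_{T\to\infty}\frac{x^T_i}{\sqrt T}=a_i\qquad\text{and}\qquad\lim_{T\to\infty}\frac{y^T_i-pT}{\sqrt T}=b_i .$$ Then $H$ is integrable on $W_k$, $Z_c\neq0$, and $\rho$ is a probability density on $\mathbb R^k$ with $\{z:\rho(z)\ne0\}=W_k^\circ$. Moreover, $\mathbb P^{0,T,x^T,y^T}_{avoid,Ber}$ is well defined for all sufficiently large $T$,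 and if $(Q^T_1,\dots,Q^T_k)$ has this law, then as $T\to\infty$ the random vectors $$Z^T=\left(\frac{Q^T_1(tT)-ptT}{\sqrt T},\dots,\frac{Q^T_k(tT)-ptT}{\sqrt T}\right)$$ converge weakly to a random vector on $\mathbb R^k$ with density $\rho$. -/

import Mathlib

open MeasureTheory ProbabilityTheory Filter Topology
open scoped BoundedContinuousFunction

namespace NoncrossingBridges

noncomputable section

/-! ### Bernoulli bridges and their non-crossing version -/

/-- The closed Weyl chamber `W_k = {x ∈ ℝ^k : x_1 ≥ x_2 ≥ ⋯ ≥ x_k}`. -/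
def weylChamber (k : ℕ) : Set (Fin k → ℝ) := {x | Antitone x}

/-- The open Weyl chamber `W_k° = {x ∈ ℝ^k : x_1 > x_2 > ⋯ > x_k}`. -/
def openWeylChamber (k : ℕ) : Set (Fin k → ℝ) := {x | StrictAnti x}

/-- The signatures of length `k`: vectors `x ∈ ℤ^k` with `x_1 ≥ x_2 ≥ ⋯ ≥ x_k`. -/
def signatures (k : ℕ) : Set (Fin k → ℤ) := {x | Antitone x}

/-- `Ω(0, T, u, v)`: the up-right paths on `{0, 1, …, T}` (integer-valued, all increments `0` or
`1`) that start at height `u` at time `0` and end at height `v` at time `T`. -/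
def upRightPaths (T : ℕ) (u v : ℤ) : Set (Fin (T + 1) → ℤ) :=
  {f | f 0 = u ∧ f (Fin.last T) = v ∧
    ∀ n : Fin T, f n.succ - f n.castSucc = 0 ∨ f n.succ - f n.castSucc = 1}

/-- The law of `k` independent Bernoulli bridges on `{0, …, T}`, the `i`-th one being uniformly
distributed on the up-right paths from `x_i` to `y_i`. -/
def bridgesLaw {k : ℕ} (T : ℕ) (x y : Fin k → ℤ) : Measure (Fin k → Fin (T + 1) → ℤ) :=
  Measure.pi fun i => uniformOn (upRightPaths T (x i) (y i))

/-- The non-crossing event `B_1(r) ≥ B_2(r) ≥ ⋯ ≥ B_k(r)` for all `r ∈ {0, …, T}`. -/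
def nonCrossing (k T : ℕ) : Set (Fin k → Fin (T + 1) → ℤ) :=
  {B | ∀ r : Fin (T + 1), Antitone fun i => B i r}

/-- The law of `k` independent Bernoulli bridges from `x` to `y`, conditioned on not crossing.
It is the zero measure if there is no non-crossing collection of bridges from `x` to `y`. -/
def avoidingLaw {k : ℕ} (T : ℕ) (x y : Fin k → ℤ) : Measure (Fin k → Fin (T + 1) → ℤ) :=
  cond (bridgesLaw T x y) (nonCrossing k T)

/-- The value at time `s ∈ [0, T]` of the path `f`, extended from `{0, …, T}` to `[0, T]` by
linear interpolation. -/
def interpolate {T : ℕ} (f : Fin (T + 1) → ℤ) (s : ℝ) : ℝ :=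
  let value : ℕ → ℝ := fun n => (f ⟨min n T, by omega⟩ : ℝ)
  value ⌊s⌋₊ + (s - ⌊s⌋₊) * (value (⌊s⌋₊ + 1) - value ⌊s⌋₊)

/-- The vector `Z^T` with coordinates `(L_i(tT) - p t T) / √T`. -/
def rescaledPositions {k T : ℕ} (p t : ℝ) (L : Fin k → Fin (T + 1) → ℤ) : Fin k → ℝ :=
  fun i => (interpolate (L i) (t * T) - p * t * T) / √(T : ℝ)

/-! ### The limiting density -/

/-- `c₁ = 1 / (p (1 - p) t)`. -/
def c₁ (p t : ℝ) : ℝ := 1 / (p * (1 - p) * t)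

/-- `c₂ = 1 / (p (1 - p) (1 - t))`. -/
def c₂ (p t : ℝ) : ℝ := 1 / (p * (1 - p) * (1 - t))

/-- `c₃ = 1 / (2 p (1 - p) t (1 - t))`. -/
def c₃ (p t : ℝ) : ℝ := 1 / (2 * p * (1 - p) * t * (1 - t))

/-- The position (counted from `0`) of the index `i` inside its block of equal entries of `a`:
if `a = (α_1, …, α_1, …, α_q, …, α_q)` with `α_1 > ⋯ > α_q` and blocks of lengths
`m_1, …, m_q`, these positions are `0, …, m_1 - 1, …, 0, …, m_q - 1`. -/
def blockPosition {k : ℕ} (a : Fin k → ℝ) (i : Fin k) : ℕ :=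
  (Finset.univ.filter fun i' => i' < i ∧ a i' = a i).card

/-- The confluent exponential determinant. For `a ∈ W_k` with blocks of equal entries
`α_1 > ⋯ > α_q` of lengths `m_1, …, m_q`, the rows of the matrix are, in this order,
`((c z_j)^(r-1) e^(c α_l z_j))_j` for `l = 1, …, q` and `r = 1, …, m_l`. -/
def confluentDet {k : ℕ} (c : ℝ) (a z : Fin k → ℝ) : ℝ :=
  (Matrix.of fun i j : Fin k =>
    (c * z j) ^ blockPosition a i * Real.exp (c * a i * z j)).det

/-- `H(z) = φ(a, z) ψ(b, z) ∏ᵢ e^(-c₃ z_i²)`. -/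
def unnormalizedDensity {k : ℕ} (p t : ℝ) (a b z : Fin k → ℝ) : ℝ :=
  confluentDet (c₁ p t) a z * confluentDet (c₂ p t) b z *
    ∏ i, Real.exp (-(c₃ p t) * z i ^ 2)

/-- `Z_c = ∫_{W_k} H(z) dz`. -/
def normalization {k : ℕ} (p t : ℝ) (a b : Fin k → ℝ) : ℝ :=
  ∫ z in weylChamber k, unnormalizedDensity p t a b z

/-- `ρ(z) = Z_c⁻¹ 1{z_1 > ⋯ > z_k} H(z)`. -/
def density {k : ℕ} (p t : ℝ) (a b : Fin k → ℝ) (z : Fin k → ℝ) : ℝ :=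
  (normalization p t a b)⁻¹ *
    (openWeylChamber k).indicator (unnormalizedDensity p t a b) z

/-! ### The conditioned law is the uniform law on non-crossing collections -/

/-- The collections of `k` non-crossing up-right paths from `x` to `y`. -/
def avoidingPaths {k : ℕ} (T : ℕ) (x y : Fin k → ℤ) : Set (Fin k → Fin (T + 1) → ℤ) :=
  {B | (∀ i, B i ∈ upRightPaths T (x i) (y i)) ∧ B ∈ nonCrossing k T}

lemma upRightPaths_finite (T : ℕ) (u v : ℤ) : (upRightPaths T u v).Finite := by
  refine Set.Finite.subset (Set.finite_Icc (fun _ => u) (fun _ => u + T)) ?_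
  rintro f ⟨h0, -, hs⟩
  have key : ∀ n : ℕ, ∀ h : n < T + 1, u ≤ f ⟨n, h⟩ ∧ f ⟨n, h⟩ ≤ u + n := by
    intro n
    induction n with
    | zero => intro h; have h1 : f ⟨0, h⟩ = u := h0; rw [h1]; simp
    | succ m ih =>
      intro h
      have h1 := ih (by omega)
      have h2 := hs ⟨m, by omega⟩
      simp only [Fin.succ_mk, Fin.castSucc_mk] at h2
      push_cast
      omega
  constructor
  · intro n; exact (key n n.2).1
  · intro n
    have h1 := (key n n.2).2
    have h2 := n.2
    show f n ≤ u + T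
    have h3 : f n ≤ u + (n : ℕ) := h1
    omega

theorem avoidingLaw_eq_uniformOn {k : ℕ} (T : ℕ) (x y : Fin k → ℤ) :
    avoidingLaw T x y = uniformOn (avoidingPaths T x y) := by
  classical
  set A : Fin k → Set (Fin (T + 1) → ℤ) := fun i => upRightPaths T (x i) (y i) with hA
  set C : ENNReal := ∏ i, (Measure.count (A i))⁻¹ with hC
  have hfin : ∀ i, (A i).Finite := fun i => upRightPaths_finite T _ _
  have hμ : bridgesLaw T x y = C • Measure.count.restrict (Set.univ.pi A) := by
    refine Measure.ext_of_singleton fun f => ?_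
    rw [bridgesLaw, Measure.pi_singleton, Measure.smul_apply,
      Measure.restrict_apply (measurableSet_singleton f), smul_eq_mul]
    have h1 : ∀ i, uniformOn (A i) {f i}
        = (Measure.count (A i))⁻¹ * (if f i ∈ A i then 1 else 0) := by
      intro i
      rw [uniformOn, cond_apply (hfin i).measurableSet]
      split_ifs with h
      · rw [Set.inter_eq_right.2 (by simpa using h), Measure.count_singleton]
      · rw [Set.inter_singleton_eq_empty.2 h]; simp
    simp only [hA] at h1
    simp_rw [h1, Finset.prod_mul_distrib]
    congr 1
    by_cases hf : ∀ i, f i ∈ A i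
    · rw [Set.inter_eq_left.2 (by simpa [Set.mem_pi] using hf), Measure.count_singleton]
      exact Finset.prod_eq_one fun i _ => by simpa using hf i
    · have h2 : ({f} : Set (Fin k → Fin (T + 1) → ℤ)) ∩ Set.univ.pi A = ∅ :=
        Set.singleton_inter_eq_empty.2 (by simpa [Set.mem_pi] using hf)
      push Not at hf
      obtain ⟨i, hi⟩ := hf
      rw [h2, measure_empty]
      exact Finset.prod_eq_zero (Finset.mem_univ i) (by simpa using hi)
  have hset : Set.univ.pi A ∩ nonCrossing k T = avoidingPaths T x y := by
    ext B; simp [avoidingPaths, hA, Set.mem_pi]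
  have hE : MeasurableSet (nonCrossing k T) := (Set.to_countable _).measurableSet
  have hP : MeasurableSet (avoidingPaths T x y) := (Set.to_countable _).measurableSet
  by_cases hne : ∃ i, A i = ∅
  · obtain ⟨i, hi⟩ := hne
    have h1 : Set.univ.pi A = ∅ := Set.univ_pi_eq_empty hi
    have h2 : avoidingPaths T x y = ∅ := by rw [← hset, h1, Set.empty_inter]
    rw [avoidingLaw, hμ, h1, h2]
    simp [ProbabilityTheory.cond]
  · push Not at hne
    have hC0 : C ≠ 0 := Finset.prod_ne_zero_iff.2 fun i _ =>
      ENNReal.inv_ne_zero.2 (Measure.count_apply_lt_top.2 (hfin i)).ne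
    have hCt : C ≠ ⊤ := ENNReal.prod_ne_top fun i _ =>
      ENNReal.inv_ne_top.2 (Measure.count_ne_zero_iff.2 (hne i))
    refine Measure.ext_of_singleton fun f => ?_
    rw [avoidingLaw, uniformOn, cond_apply hE, cond_apply hP, hμ]
    simp only [Measure.smul_apply, smul_eq_mul, Measure.restrict_apply hE,
      Measure.restrict_apply (hE.inter (measurableSet_singleton f))]
    rw [Set.inter_right_comm, Set.inter_comm (nonCrossing k T) (Set.univ.pi A), hset,
      ENNReal.mul_inv (Or.inl hC0) (Or.inl hCt), mul_mul_mul_comm,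
      ENNReal.inv_mul_cancel hC0 hCt, one_mul]

end

end NoncrossingBridges

open NoncrossingBridges

/-!
The law of the positions at an integer time `m` is explicit. By the Lindström–Gessel–Viennot
identity (`card_avoidingFinset`) the number of non-crossing collections is a determinant of
binomial coefficients, and by the Markov property (`sum_avoidingFinset_eval`) the mass at `z` is
proportional to `det [C(m, z_j - x_i)] * det [C(T - m, y_j - z_i)]`. Powers of `p` and `1 - p` can be
inserted, since the factors that depend on `z` cancel in the product; time reversal turns the second
determinant into one of the first type with `p` and `1 - p` exchanged. Hence everything reduces to
one local limit theorem, for `det [√T * P(S_m = z_j - x_i)]` with `S_m` binomial.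

If entries of `a` coincide, rows of this determinant merge in the limit. Passing to divided
differences in the `x_i` along the blocks of equal entries of `a` multiplies the determinant by a
nonzero constant that does not depend on `z`, and so does not change the law. The binomial weights are
Fourier integrals of `x ↦ e^{W x}` along a vertical line that may be chosen freely, so their divided
differences are the same integrals with divided differences of exponentials, which the mean value
theorem (`exists_re_expDivDiff`) compares with derivatives. The line through the saddle point gives
the limit (`integral_saddle`): row operations within the blocks turn it into the confluent
exponential determinant times a Gaussian factor (`exists_tendsto_scaledDet`). The lines with real
part `±1` give an exponentially decaying bound (`exists_scaledDet_le`).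

Sums over lattice points are integrals of step functions, so dominated convergence gives the
convergence of the weights integrated against test functions, and the unknown constants cancel in
the quotient. The limit is a probability density because the confluent determinant has no zeros in
the open chamber (`confluentDet_ne_zero`, by iterating Rolle's theorem) and the chamber is connected.
Linear interpolation moves the positions by at most `1 / √T`, which bounded Lipschitz test
functions do not see.
-/

/-! ### Counting non-crossing collections of paths -/

namespace NoncrossingBridges

lemma avoidingPaths_finite {k : ℕ} (T : ℕ) (x y : Fin k → ℤ) : (avoidingPaths T x y).Finite :=
  (Set.Finite.pi' fun i => upRightPaths_finite T (x i) (y i)).subset fun _ hB => hB.1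

/-- The set `avoidingPaths T x y` as a finset. -/
noncomputable def avoidingFinset {k : ℕ} (T : ℕ) (x y : Fin k → ℤ) :
    Finset (Fin k → Fin (T + 1) → ℤ) :=
  (avoidingPaths_finite T x y).toFinset

lemma mem_avoidingFinset {k T : ℕ} {x y : Fin k → ℤ} {B : Fin k → Fin (T + 1) → ℤ} :
    B ∈ avoidingFinset T x y ↔
      (∀ i, B i ∈ upRightPaths T (x i) (y i)) ∧ ∀ r, Antitone fun i => B i r := by
  simp [avoidingFinset, avoidingPaths, nonCrossing]

lemma avoidingFinset_eq_empty_of_not_antitone {k T : ℕ} {x y : Fin k → ℤ} (hx : ¬ Antitone x) :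
    avoidingFinset T x y = ∅ := by
  refine Finset.eq_empty_of_forall_notMem fun B hB => hx ?_
  rw [mem_avoidingFinset] at hB
  have h := hB.2 0
  simpa [(hB.1 _).1] using h

lemma cons_mem_upRightPaths {T : ℕ} {u v e : ℤ} (he : e = 0 ∨ e = 1) {f : Fin (T + 1) → ℤ}
    (hf : f ∈ upRightPaths T (u + e) v) :
    (Fin.cons u f : Fin (T + 2) → ℤ) ∈ upRightPaths (T + 1) u v := by
  obtain ⟨h0, h1, h2⟩ := hf
  refine ⟨rfl, ?_, fun n => ?_⟩
  · rw [← Fin.succ_last, Fin.cons_succ, h1]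
  · refine Fin.cases ?_ (fun m => ?_) n
    · simp [h0, he]
    · have := h2 m
      rw [← Fin.succ_castSucc, Fin.cons_succ, Fin.cons_succ]
      exact this

lemma tail_mem_upRightPaths {T : ℕ} {u v : ℤ} {f : Fin (T + 2) → ℤ}
    (hf : f ∈ upRightPaths (T + 1) u v) :
    Fin.tail f ∈ upRightPaths T (f 1) v := by
  obtain ⟨_, h1, h2⟩ := hf
  refine ⟨rfl, ?_, fun n => ?_⟩
  · rw [← h1, Fin.tail, Fin.succ_last]
  · have := h2 n.succ
    rwa [← Fin.succ_castSucc] at this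

/-- Sums over non-crossing collections, decomposed according to the first step. -/
lemma sum_avoidingFinset_succ {k T : ℕ} {x y : Fin k → ℤ} (hx : Antitone x)
    (F : (Fin k → Fin (T + 2) → ℤ) → ℝ) :
    ∑ B ∈ avoidingFinset (T + 1) x y, F B =
      ∑ e : Fin k → Fin 2, ∑ B ∈ avoidingFinset T (fun i => x i + (e i : ℤ)) y,
        F fun i => Fin.cons (x i) (B i) := by
  rw [Finset.sum_sigma']
  symm
  refine Finset.sum_bij (fun s _ => fun i => Fin.cons (x i) (s.2 i)) ?_ ?_ ?_ ?_
  · rintro ⟨e, B⟩ hB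
    simp only [Finset.mem_sigma, Finset.mem_univ, true_and, mem_avoidingFinset] at hB ⊢
    refine ⟨fun i => cons_mem_upRightPaths ?_ (hB.1 i), fun r => ?_⟩
    · have := (e i).2
      omega
    · refine Fin.cases ?_ (fun r => ?_) r
      · simpa using hx
      · simpa using hB.2 r
  · rintro ⟨e, B⟩ hB ⟨e', B'⟩ hB' h
    simp only [Finset.mem_sigma, Finset.mem_univ, true_and, mem_avoidingFinset] at hB hB' h
    have h1 : B = B' := by
      funext i
      exact (Fin.cons_injective2 (congrFun h i)).2
    subst h1
    have h2 : e = e' := by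
      funext i
      have h3 := (hB.1 i).1
      have h4 := (hB'.1 i).1
      have : (e i : ℤ) = e' i := by
        have := h3.symm.trans h4
        simpa using this
      exact Fin.ext (by exact_mod_cast this)
    rw [h2]
  · intro B hB
    rw [mem_avoidingFinset] at hB
    have hstep : ∀ i, B i 1 - B i 0 = 0 ∨ B i 1 - B i 0 = 1 := fun i => (hB.1 i).2.2 0
    refine ⟨⟨fun i => if B i 1 - B i 0 = 0 then 0 else 1, fun i => Fin.tail (B i)⟩, ?_, ?_⟩
    · simp only [Finset.mem_sigma, Finset.mem_univ, true_and, mem_avoidingFinset]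
      refine ⟨fun i => ?_, fun r => hB.2 r.succ⟩
      convert tail_mem_upRightPaths (hB.1 i) using 1
      have h0 : B i 0 = x i := (hB.1 i).1
      rcases hstep i with h | h
      · simp only [h, if_true, Fin.val_zero]
        congr 1
        push_cast
        omega
      · simp only [h, one_ne_zero, if_false, Fin.val_one]
        congr 1
        push_cast
        omega
    · funext i
      have h0 : B i 0 = x i := (hB.1 i).1
      simp only [← h0]
      exact Fin.cons_self_tail (B i)
  · rintro ⟨e, B⟩ hB
    rfl

lemma avoidingFinset_zero_self {k : ℕ} {x : Fin k → ℤ} (hx : Antitone x) :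
    avoidingFinset 0 x x = {fun i _ => x i} := by
  ext B
  rw [mem_avoidingFinset, Finset.mem_singleton]
  constructor
  · rintro ⟨h, -⟩
    funext i r
    rw [Fin.fin_one_eq_zero r]
    exact (h i).1
  · rintro rfl
    exact ⟨fun i => ⟨rfl, rfl, fun n => n.elim0⟩, fun _ => hx⟩

lemma avoidingFinset_zero_of_ne {k : ℕ} {x y : Fin k → ℤ} (hxy : x ≠ y) :
    avoidingFinset 0 x y = ∅ := by
  refine Finset.eq_empty_of_forall_notMem fun B hB => hxy ?_
  rw [mem_avoidingFinset] at hB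
  funext i
  rw [← (hB.1 i).1, ← (hB.1 i).2.1]
  rfl

/-- The binomial coefficient `C(T, l)` for an integer `l`; it is `0` for `l < 0`. -/
noncomputable def intChoose (T : ℕ) (l : ℤ) : ℝ := if 0 ≤ l then (T.choose l.toNat : ℝ) else 0

lemma intChoose_succ (T : ℕ) (l : ℤ) :
    intChoose (T + 1) l = intChoose T l + intChoose T (l - 1) := by
  unfold intChoose
  rcases lt_trichotomy l 0 with h | h | h
  · rw [if_neg (by omega), if_neg (by omega), if_neg (by omega)]; simp
  · subst h; simp
  · obtain ⟨n, rfl⟩ : ∃ n : ℕ, l = n + 1 := ⟨(l - 1).toNat, by omega⟩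
    rw [if_pos (by omega), if_pos (by omega), if_pos (by omega)]
    have h1 : ((n : ℤ) + 1).toNat = n + 1 := by omega
    have h2 : ((n : ℤ) + 1 - 1).toNat = n := by omega
    rw [h1, h2, Nat.choose_succ_succ]
    push_cast
    ring

lemma intChoose_zero (l : ℤ) : intChoose 0 l = if l = 0 then 1 else 0 := by
  unfold intChoose
  rcases lt_trichotomy l 0 with h | h | h
  · rw [if_neg (by omega), if_neg (by omega)]
  · subst h; simp
  · rw [if_pos (by omega), if_neg (by omega), Nat.choose_eq_zero_of_lt (by omega)]; simp

/-- The shift `x_i ↦ x_i - i`, which turns weakly decreasing vectors into strictly decreasing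
ones. -/
def strictShift {k : ℕ} (x : Fin k → ℤ) (i : Fin k) : ℤ := x i - (i : ℤ)

lemma strictAnti_strictShift {k : ℕ} {x : Fin k → ℤ} (hx : Antitone x) :
    StrictAnti (strictShift x) := by
  intro i j hij
  have h1 := hx hij.le
  have h2 : (i : ℕ) < j := hij
  simp only [strictShift]
  omega

/-- The Lindström–Gessel–Viennot determinant `det [C(T, y_j - x_i)]`. -/
noncomputable def chooseDet {k : ℕ} (T : ℕ) (x y : Fin k → ℤ) : ℝ :=
  (Matrix.of fun i j => intChoose T (y j - x i)).det

lemma chooseDet_succ {k : ℕ} (T : ℕ) (x y : Fin k → ℤ) :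
    chooseDet (T + 1) x y = ∑ e : Fin k → Fin 2, chooseDet T (fun i => x i + (e i : ℤ)) y := by
  have h := (Matrix.detRowAlternating (n := Fin k) (R := ℝ)).toMultilinearMap.map_sum
    (fun (i : Fin k) (e : Fin 2) (j : Fin k) => intChoose T (y j - (x i + (e : ℤ))))
  refine Eq.trans ?_ h
  change Matrix.det _ = Matrix.det _
  congr 1
  ext i j
  simp only [Matrix.of_apply, Finset.sum_apply, Fin.sum_univ_two]
  rw [intChoose_succ]
  simp [sub_sub]

lemma chooseDet_eq_zero_of_not_antitone {k T : ℕ} {x y : Fin k → ℤ} (hx : Antitone x)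
    {e : Fin k → Fin 2} (he : ¬ Antitone fun i => x i + (e i : ℤ)) :
    chooseDet T (strictShift fun i => x i + (e i : ℤ)) y = 0 := by
  cases k with
  | zero => exact absurd (fun i => i.elim0) he
  | succ n =>
    rw [Fin.antitone_iff_succ_le] at he
    push Not at he
    obtain ⟨i, hi⟩ := he
    refine Matrix.det_zero_of_row_eq (i := i.castSucc) (j := i.succ) (Fin.castSucc_lt_succ).ne ?_
    have h1 := hx (Fin.castSucc_lt_succ (i := i)).le
    have h2 := (e i.castSucc).2
    have h3 := (e i.succ).2
    funext j
    simp only [Matrix.of_apply, strictShift]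
    congr 2
    simp only [Fin.val_castSucc, Fin.val_succ]
    omega

lemma chooseDet_zero {k : ℕ} {x y : Fin k → ℤ} (hx : StrictAnti x) (hy : StrictAnti y) :
    chooseDet 0 x y = if x = y then 1 else 0 := by
  split_ifs with h
  · subst h
    rw [chooseDet, ← Matrix.det_one (n := Fin k) (R := ℝ)]
    congr 1
    ext i j
    simp only [Matrix.of_apply, intChoose_zero, Matrix.one_apply, sub_eq_zero, hx.injective.eq_iff,
      eq_comm]
  · by_contra hdet
    refine h ?_
    have hsub : Set.range x ⊆ Set.range y := by
      rintro _ ⟨i, rfl⟩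
      by_contra hi
      refine hdet (Matrix.det_eq_zero_of_row_eq_zero i fun j => ?_)
      rw [Matrix.of_apply, intChoose_zero, if_neg]
      intro h0
      exact hi ⟨j, by omega⟩
    have hrange : Set.range x = Set.range y := by
      refine Set.eq_of_subset_of_ncard_le hsub ?_ (Set.finite_range y)
      rw [← Set.image_univ, ← Set.image_univ, Set.ncard_image_of_injective _ hx.injective,
        Set.ncard_image_of_injective _ hy.injective]
    exact (hx.range_inj hy).1 hrange

/-- The number of non-crossing collections is a determinant of binomial coefficients. Both sides
satisfy the same recursion in `T`; a first step that leaves the chamber makes two rows of the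
determinant equal. -/
theorem card_avoidingFinset {k : ℕ} (T : ℕ) {x y : Fin k → ℤ} (hx : Antitone x)
    (hy : Antitone y) :
    ((avoidingFinset T x y).card : ℝ) = chooseDet T (strictShift x) (strictShift y) := by
  induction T generalizing x with
  | zero =>
    rw [chooseDet_zero (strictAnti_strictShift hx) (strictAnti_strictShift hy)]
    by_cases h : x = y
    · subst h
      simp [avoidingFinset_zero_self hx]
    · rw [avoidingFinset_zero_of_ne h, if_neg]
      · simp
      · intro h'
        refine h (funext fun i => ?_)
        have := congrFun h' i
        simpa [strictShift] using this
  | succ T ih =>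
    have h1 := sum_avoidingFinset_succ (T := T) (y := y) hx (fun _ => (1 : ℝ))
    simp only [Finset.sum_const, nsmul_eq_mul, mul_one] at h1
    rw [h1, chooseDet_succ]
    refine Finset.sum_congr rfl fun e _ => ?_
    have hs : (fun i => strictShift x i + (e i : ℤ)) = strictShift fun i => x i + (e i : ℤ) := by
      funext i; simp only [strictShift]; ring
    rw [hs]
    by_cases he : Antitone fun i => x i + (e i : ℤ)
    · exact ih he
    · rw [avoidingFinset_eq_empty_of_not_antitone he, chooseDet_eq_zero_of_not_antitone hx he]
      simp

/-- The Markov property: the sum over the non-crossing collections of a function of the position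
at time `m`. The index set `Z` may be any finite set of vectors that contains all those that are
within reach of `x` at time `m`. -/
theorem sum_avoidingFinset_eval {k : ℕ} (m n T : ℕ) (hT : T = m + n) {x y : Fin k → ℤ}
    (F : (Fin k → ℤ) → ℝ) (Z : Finset (Fin k → ℤ))
    (hZ : ∀ z : Fin k → ℤ, (∀ i, x i ≤ z i ∧ z i ≤ x i + m) → z ∈ Z) :
    ∑ B ∈ avoidingFinset T x y, F (fun i => B i ⟨m, by omega⟩) =
      ∑ z ∈ Z, ((avoidingFinset m x z).card * (avoidingFinset n z y).card * F z : ℝ) := by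
  induction m generalizing x T with
  | zero =>
    obtain rfl : T = n := by omega
    by_cases hx : Antitone x
    · rw [Finset.sum_eq_single_of_mem x (hZ x fun i => by simp)]
      · rw [avoidingFinset_zero_self hx]
        simp only [Finset.card_singleton, Nat.cast_one, one_mul]
        rw [← nsmul_eq_mul, ← Finset.sum_const]
        refine Finset.sum_congr rfl fun B hB => ?_
        rw [mem_avoidingFinset] at hB
        congr 1
        funext i
        exact (hB.1 i).1
      · intro z _ hz
        rw [avoidingFinset_zero_of_ne hz.symm]
        simp
    · rw [avoidingFinset_eq_empty_of_not_antitone hx, Finset.sum_empty]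
      exact (Finset.sum_eq_zero fun z _ => by
        rw [avoidingFinset_eq_empty_of_not_antitone hx]; simp).symm
  | succ m ih =>
    obtain ⟨S, rfl⟩ : ∃ S, T = S + 1 := ⟨m + n, by omega⟩
    by_cases hx : Antitone x
    · have hcard : ∀ z, ((avoidingFinset (m + 1) x z).card : ℝ) =
          ∑ e : Fin k → Fin 2, ((avoidingFinset m (fun i => x i + (e i : ℤ)) z).card : ℝ) := by
        intro z
        simpa using sum_avoidingFinset_succ (T := m) (y := z) hx (fun _ => (1 : ℝ))
      rw [sum_avoidingFinset_succ hx]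
      simp only [hcard, Finset.sum_mul]
      rw [Finset.sum_comm]
      refine Finset.sum_congr rfl fun e _ => ?_
      refine ih S (by omega) fun z hz => hZ z fun i => ?_
      have h1 := hz i
      have h2 := (e i).2
      push_cast
      omega
    · rw [avoidingFinset_eq_empty_of_not_antitone hx, Finset.sum_empty]
      exact (Finset.sum_eq_zero fun z _ => by
        rw [avoidingFinset_eq_empty_of_not_antitone hx]; simp).symm

lemma le_and_le_of_mem_upRightPaths {T : ℕ} {u v : ℤ} {f : Fin (T + 1) → ℤ}
    (hf : f ∈ upRightPaths T u v) : u ≤ v ∧ v ≤ u + T := by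
  induction T generalizing u with
  | zero => rw [← hf.1, ← hf.2.1]; simp
  | succ T ih =>
    have h := ih (tail_mem_upRightPaths hf)
    have h1 : f 1 - f 0 = 0 ∨ f 1 - f 0 = 1 := hf.2.2 0
    have h2 : f 0 = u := hf.1
    push_cast
    omega

lemma avoidingFinset_eq_empty {k T : ℕ} {x y : Fin k → ℤ}
    (h : ¬ ∀ i, x i ≤ y i ∧ y i ≤ x i + T) : avoidingFinset T x y = ∅ := by
  refine Finset.eq_empty_of_forall_notMem fun B hB => h fun i => ?_
  rw [mem_avoidingFinset] at hB
  exact le_and_le_of_mem_upRightPaths (hB.1 i)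

/-! ### Rolle's theorem and exponential polynomials -/

/-- Iterated Rolle theorem for a chain of first-order operators: if `F (j + 1) = (D - b j) (F j)`
and `F 0` has `n + 1` zeros in an interval, then `F n` has a zero in that interval. -/
lemma exists_zero_of_chain (n : ℕ) (F : ℕ → ℝ → ℝ) (b : ℕ → ℝ)
    (hF : ∀ j x, HasDerivAt (F j) (F (j + 1) x + b j * F j x) x) (lo hi : ℝ) (z : Fin (n + 1) → ℝ)
    (hz : StrictMono z) (hmem : ∀ i, z i ∈ Set.Icc lo hi) (hzero : ∀ i, F 0 (z i) = 0) :
    ∃ ξ ∈ Set.Icc lo hi, F n ξ = 0 := by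
  induction n generalizing F b with
  | zero => exact ⟨z 0, hmem 0, hzero 0⟩
  | succ n ih =>
    -- Rolle's theorem for `exp (-b 0 * x) * F 0 x`
    have key : ∀ i : Fin (n + 1), ∃ ξ ∈ Set.Ioo (z i.castSucc) (z i.succ), F 1 ξ = 0 := by
      intro i
      have hd : ∀ x, HasDerivAt (fun x => Real.exp (-b 0 * x) * F 0 x)
          (Real.exp (-b 0 * x) * F 1 x) x := by
        intro x
        have h1 : HasDerivAt (fun x : ℝ => Real.exp (-b 0 * x)) (Real.exp (-b 0 * x) * (-b 0)) x := by
          simpa using ((hasDerivAt_id x).const_mul (-b 0)).exp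
        convert! h1.mul (hF 0 x) using 1
        ring
      obtain ⟨ξ, hξ, h0⟩ := exists_hasDerivAt_eq_zero (hz (Fin.castSucc_lt_succ (i := i)))
        (fun x _ => (hd x).continuousAt.continuousWithinAt)
        (by simp only [hzero, mul_zero]) (fun x _ => hd x)
      exact ⟨ξ, hξ, (mul_eq_zero.1 h0).resolve_left (Real.exp_pos _).ne'⟩
    choose w hw hw0 using key
    obtain ⟨ξ, hξ, h⟩ := ih (fun j => F (j + 1)) (fun j => b (j + 1)) (fun j x => hF (j + 1) x) w
      (Fin.strictMono_iff_lt_succ.2 fun i => (hw _).2.trans_le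
        ((hz.monotone (by simp)).trans (hw i.succ).1.le))
      (fun i => ⟨(hmem _).1.trans (hw i).1.le, (hw i).2.le.trans (hmem _).2⟩) hw0
    exact ⟨ξ, hξ, h⟩

lemma exists_zero_of_chain_finset (n : ℕ) (F : ℕ → ℝ → ℝ) (b : ℕ → ℝ)
    (hF : ∀ j x, HasDerivAt (F j) (F (j + 1) x + b j * F j x) x) (lo hi : ℝ) (S : Finset ℝ)
    (hS : n + 1 ≤ S.card) (hmem : ∀ x ∈ S, x ∈ Set.Icc lo hi) (hzero : ∀ x ∈ S, F 0 x = 0) :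
    ∃ ξ ∈ Set.Icc lo hi, F n ξ = 0 := by
  obtain ⟨S', hS', hcard⟩ := Finset.exists_subset_card_eq hS
  exact exists_zero_of_chain n F b hF lo hi (S'.orderEmbOfFin hcard)
    (S'.orderEmbOfFin hcard).strictMono
    (fun i => hmem _ (hS' (S'.orderEmbOfFin_mem hcard i)))
    (fun i => hzero _ (hS' (S'.orderEmbOfFin_mem hcard i)))

open Polynomial in
/-- The polynomials `Q_j` with `Q_j e^{β x} = (D - b_{j-1}) ⋯ (D - b_0) (P e^{β x})`. -/
noncomputable def expChain (b : ℕ → ℝ) (β : ℝ) (P : ℝ[X]) : ℕ → ℝ[X]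
  | 0 => P
  | j + 1 => derivative (expChain b β P j) + C (β - b j) * expChain b β P j

open Polynomial in
lemma hasDerivAt_expChain (b : ℕ → ℝ) (β : ℝ) (P : ℝ[X]) (j : ℕ) (x : ℝ) :
    HasDerivAt (fun x => (expChain b β P j).eval x * Real.exp (β * x))
      ((expChain b β P (j + 1)).eval x * Real.exp (β * x) +
        b j * ((expChain b β P j).eval x * Real.exp (β * x))) x := by
  have h1 : HasDerivAt (fun x : ℝ => Real.exp (β * x)) (Real.exp (β * x) * β) x := by
    simpa using ((hasDerivAt_id x).const_mul β).exp
  convert! ((expChain b β P j).hasDerivAt x).mul h1 using 1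
  simp only [expChain, eval_add, eval_mul, eval_C]
  ring

/-- Each factor `D - β` lowers the degree of `P` in `P e^{β x}` by one, the other factors keep
it. -/
lemma expChain_spec (b : ℕ → ℝ) (β : ℝ) {P : Polynomial ℝ} (hP : P ≠ 0) (j : ℕ) :
    (P.natDegree < ((Finset.range j).filter fun l => b l = β).card ∧ expChain b β P j = 0) ∨
      (expChain b β P j ≠ 0 ∧ (expChain b β P j).natDegree +
        ((Finset.range j).filter fun l => b l = β).card = P.natDegree) := by
  induction j with
  | zero => right; simp [expChain, hP]
  | succ j ih =>
    rw [Finset.range_add_one, Finset.filter_insert]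
    by_cases hb : b j = β
    · rw [if_pos hb, Finset.card_insert_of_notMem (by simp)]
      simp only [expChain, hb, sub_self, map_zero, zero_mul, add_zero]
      rcases ih with ⟨h1, h2⟩ | ⟨h1, h2⟩
      · left; rw [h2]; exact ⟨by omega, by simp⟩
      · by_cases h3 : (expChain b β P j).natDegree = 0
        · left
          exact ⟨by omega, Polynomial.derivative_of_natDegree_zero h3⟩
        · right
          have h4 := Polynomial.natDegree_eq_of_degree_eq_some
            (Polynomial.degree_derivative h3)
          refine ⟨fun h0 => h3 (Polynomial.derivative_eq_zero.1 h0), ?_⟩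
          omega
    · rw [if_neg hb]
      simp only [expChain]
      rcases ih with ⟨h1, h2⟩ | ⟨h1, h2⟩
      · left; rw [h2]; exact ⟨h1, by simp⟩
      · right
        have hc : β - b j ≠ 0 := sub_ne_zero.2 (Ne.symm hb)
        have hC : (Polynomial.C (β - b j) * expChain b β P j).degree = (expChain b β P j).degree :=
          Polynomial.degree_C_mul hc
        have hdeg : (Polynomial.derivative (expChain b β P j) +
            Polynomial.C (β - b j) * expChain b β P j).degree = (expChain b β P j).degree := by
          rw [Polynomial.degree_add_eq_right_of_degree_lt, hC]
          rw [hC]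
          exact Polynomial.degree_derivative_lt h1
        refine ⟨fun h0 => h1 ?_, ?_⟩
        · rw [h0, Polynomial.degree_zero] at hdeg
          exact Polynomial.degree_eq_bot.1 hdeg.symm
        · rw [Polynomial.natDegree_eq_of_degree_eq hdeg, h2]

/-- The extension by `0` of a finite sequence of reals. -/
noncomputable def extendSeq {k : ℕ} (β : Fin k → ℝ) (l : ℕ) : ℝ :=
  if h : l < k then β ⟨l, h⟩ else 0

lemma extendSeq_val {k : ℕ} (β : Fin k → ℝ) (i : Fin k) : extendSeq β i = β i := by
  simp [extendSeq]

lemma card_filter_extendSeq {k : ℕ} (β : Fin k → ℝ) (i : Fin k) (v : ℝ) :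
    ((Finset.range i).filter fun l => extendSeq β l = v).card =
      (Finset.univ.filter fun i' => i' < i ∧ β i' = v).card := by
  symm
  refine Finset.card_bij (fun i' _ => (i' : ℕ)) ?_ (fun _ _ _ _ h => Fin.ext h) ?_
  · intro i' hi'
    simp only [Finset.mem_filter, Finset.mem_univ, true_and] at hi'
    simp only [Finset.mem_filter, Finset.mem_range, extendSeq_val]
    exact hi'
  · intro l hl
    simp only [Finset.mem_filter, Finset.mem_range] at hl
    refine ⟨⟨l, hl.1.trans i.2⟩, ?_, rfl⟩
    simp only [Finset.mem_filter, Finset.mem_univ, true_and]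
    exact ⟨hl.1, by simpa [extendSeq, hl.1.trans i.2] using hl.2⟩

/-- The confluent exponential determinant does not vanish at points with distinct coordinates:
a linear combination of the rows is an exponential polynomial with `k` zeros, and applying the
operators `D - c a_i` that belong to the rows before the last row involved leaves a multiple of a
single exponential. -/
theorem confluentDet_ne_zero {k : ℕ} {c : ℝ} (hc : c ≠ 0) (a : Fin k → ℝ) {z : Fin k → ℝ}
    (hz : Function.Injective z) : confluentDet c a z ≠ 0 := by
  intro hdet
  obtain ⟨v, hv0, hv⟩ := Matrix.exists_vecMul_eq_zero_iff.2 hdet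
  have hne : (Finset.univ.filter fun i => v i ≠ 0).Nonempty := by
    obtain ⟨i, hi⟩ := Function.ne_iff.1 hv0
    exact ⟨i, by simpa using hi⟩
  obtain ⟨i₀, hi₀, hmax⟩ := Finset.exists_max_image _ id hne
  have hvi₀ : v i₀ ≠ 0 := by simpa using hi₀
  have hbig : ∀ i, i₀ < i → v i = 0 := by
    intro i hi
    by_contra h
    exact absurd (hmax i (by simpa using h)) (not_le.2 hi)
  set P : Fin k → Polynomial ℝ := fun i =>
    Polynomial.C (v i * c ^ blockPosition a i) * Polynomial.X ^ blockPosition a i with hPdef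
  set β : Fin k → ℝ := fun i => c * a i with hβ
  set b := extendSeq β with hb
  have hP0 : ∀ i, v i ≠ 0 → P i ≠ 0 := fun i hi => by
    simp [hPdef, hi, hc]
  have hPdeg : ∀ i, v i ≠ 0 → (P i).natDegree = blockPosition a i := fun i hi =>
    Polynomial.natDegree_C_mul_X_pow _ _ (mul_ne_zero hi (pow_ne_zero _ hc))
  have hcount : ∀ i j : Fin k, ((Finset.range j).filter fun l => b l = β i).card =
      (Finset.univ.filter fun i' => i' < j ∧ a i' = a i).card := by
    intro i j
    rw [hb, card_filter_extendSeq]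
    congr 1
    ext i'
    simp [hβ, hc]
  set F : ℕ → ℝ → ℝ := fun j x => ∑ i, (expChain b (β i) (P i) j).eval x * Real.exp (β i * x)
    with hF
  have hFd : ∀ j x, HasDerivAt (F j) (F (j + 1) x + b j * F j x) x := by
    intro j x
    have := HasDerivAt.fun_sum (u := Finset.univ)
      (fun i _ => hasDerivAt_expChain b (β i) (P i) j x)
    rw [Finset.sum_add_distrib, ← Finset.mul_sum] at this
    exact this
  have hzeros : ∀ x ∈ Finset.univ.image z, F 0 x = 0 := by
    intro x hx
    obtain ⟨j, -, rfl⟩ := Finset.mem_image.1 hx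
    have := congrFun hv j
    simp only [Matrix.vecMul, dotProduct, Matrix.of_apply, Pi.zero_apply] at this
    rw [← this]
    refine Finset.sum_congr rfl fun i _ => ?_
    simp [expChain, hPdef, hβ, mul_pow]
    ring
  obtain ⟨R, hR⟩ : ∃ R : ℝ, ∀ j, |z j| ≤ R :=
    ⟨∑ j, |z j|, fun j => Finset.single_le_sum (f := fun j => |z j|)
      (fun _ _ => abs_nonneg _) (Finset.mem_univ j)⟩
  obtain ⟨ξ, -, hξ⟩ := exists_zero_of_chain_finset i₀ F b hFd (-R) R (Finset.univ.image z)
    (by rw [Finset.card_image_of_injective _ hz]; simp)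
    (fun x hx => by
      obtain ⟨j, -, rfl⟩ := Finset.mem_image.1 hx
      exact abs_le.1 (hR j)) hzeros
  have hother : ∀ i ∈ Finset.univ, i ≠ i₀ →
      (expChain b (β i) (P i) i₀).eval ξ * Real.exp (β i * ξ) = 0 := by
    intro i _ hi
    have hzero : ∀ j, expChain b (β i) 0 j = 0 := by
      intro j
      induction j with
      | zero => rfl
      | succ j ih => simp [expChain, ih]
    by_cases hvi : v i = 0
    · have : P i = 0 := by simp [hPdef, hvi]
      rw [this, hzero]; simp
    · have hlt : i < i₀ := lt_of_le_of_ne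
        (not_lt.1 fun h => hvi (hbig i h)) hi
      rcases expChain_spec b (β i) (hP0 i hvi) i₀ with ⟨-, h⟩ | ⟨-, h⟩
      · rw [h]; simp
      · exfalso
        rw [hPdeg i hvi, hcount, blockPosition] at h
        have : (Finset.univ.filter fun i' => i' < i ∧ a i' = a i).card <
            (Finset.univ.filter fun i' => i' < i₀ ∧ a i' = a i).card := by
          refine Finset.card_lt_card (Finset.ssubset_iff_of_subset ?_ |>.2 ⟨i, ?_, ?_⟩)
          · intro i' hi'
            simp only [Finset.mem_filter, Finset.mem_univ, true_and] at hi' ⊢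
            exact ⟨hi'.1.trans hlt, hi'.2⟩
          · simpa using hlt
          · simp
        omega
  rw [hF] at hξ
  simp only at hξ
  rw [Finset.sum_eq_single_of_mem i₀ (Finset.mem_univ _) hother] at hξ
  rcases expChain_spec b (β i₀) (hP0 i₀ hvi₀) i₀ with ⟨h, -⟩ | ⟨h1, h2⟩
  · rw [hPdeg i₀ hvi₀, hcount, blockPosition] at h
    exact lt_irrefl _ h
  · rw [hPdeg i₀ hvi₀, hcount, blockPosition] at h2
    have hdeg : (expChain b (β i₀) (P i₀) i₀).natDegree = 0 := by omega
    rw [Polynomial.eq_C_of_natDegree_eq_zero hdeg, Polynomial.eval_C] at hξ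
    refine h1 ?_
    rw [Polynomial.eq_C_of_natDegree_eq_zero hdeg,
      (mul_eq_zero.1 hξ).resolve_right (Real.exp_pos _).ne', map_zero]

lemma continuous_confluentDet {k : ℕ} (c : ℝ) (a : Fin k → ℝ) : Continuous (confluentDet c a) := by
  unfold confluentDet
  refine Continuous.matrix_det (continuous_matrix fun i j => ?_)
  simp only [Matrix.of_apply]
  fun_prop

lemma confluentDet_eq_zero {k : ℕ} (c : ℝ) (a : Fin k → ℝ) {z : Fin k → ℝ}
    (hz : ¬ Function.Injective z) : confluentDet c a z = 0 := by
  simp only [Function.Injective, not_forall] at hz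
  obtain ⟨i, j, hij, hne⟩ := hz
  exact Matrix.det_zero_of_column_eq hne fun l => by simp [hij]

/-! ### Divided differences of exponentials -/

/-- The divided difference of the exponential `ξ ↦ e^{W ξ}` at the nodes `v i`, `i ∈ s`. -/
noncomputable def expDivDiff {ι : Type*} [DecidableEq ι] (s : Finset ι) (v : ι → ℝ) (W : ℂ) : ℂ :=
  ∑ i ∈ s, ((∏ j ∈ s.erase i, (v i - v j))⁻¹ : ℝ) * Complex.exp (W * v i)

/-- Mean value theorem for the divided differences of the real part of `A e^{W ξ}`. -/
lemma exists_re_expDivDiff {ι : Type*} [DecidableEq ι] {s : Finset ι} {n : ℕ} (hs : s.card = n + 1)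
    {v : ι → ℝ} (hv : Set.InjOn v s) (A W : ℂ) {lo hi : ℝ} (hmem : ∀ i ∈ s, v i ∈ Set.Icc lo hi) :
    ∃ ξ ∈ Set.Icc lo hi,
      (A * expDivDiff s v W).re = (A * (W ^ n * Complex.exp (W * ξ))).re / n.factorial := by
  set f : ℝ → ℝ := fun x => (A * Complex.exp (W * x)).re with hf
  set P := Lagrange.interpolate s v (fun i => f (v i)) with hP
  have hdeg : P.degree < s.card := Lagrange.degree_interpolate_lt _ hv
  have hcoeff := Lagrange.coeff_eq_sum hv hdeg
  have heval : ∀ i ∈ s, P.eval (v i) = f (v i) := fun i hi =>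
    Lagrange.eval_interpolate_at_node _ hv hi
  set F : ℕ → ℝ → ℝ := fun j x =>
    (A * (W ^ j * Complex.exp (W * x))).re - (Polynomial.derivative^[j] P).eval x with hF
  have hFd : ∀ j x, HasDerivAt (F j) (F (j + 1) x + 0 * F j x) x := by
    intro j x
    have h1 : HasDerivAt (fun x : ℝ => Complex.exp (W * x)) (Complex.exp (W * x) * W) x := by
      have := (((hasDerivAt_id (x : ℂ)).const_mul W).cexp).comp_ofReal
      simpa using this
    have h2 := ((h1.const_mul (W ^ j)).const_mul A)
    have h3 : HasDerivAt (fun x : ℝ => (A * (W ^ j * Complex.exp (W * x))).re)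
        (A * (W ^ j * (Complex.exp (W * x) * W))).re x := by
      have := Complex.reCLM.hasFDerivAt.comp_hasDerivAt x h2
      simpa using! this
    convert! h3.sub ((Polynomial.derivative^[j] P).hasDerivAt x) using 1
    simp only [hF, Function.iterate_succ', Function.comp, pow_succ, zero_mul, add_zero]
    congr 3
    ring
  obtain ⟨ξ, hξ, h0⟩ := exists_zero_of_chain_finset n F (fun _ => 0) hFd lo hi (s.image v)
    (by rw [Finset.card_image_of_injOn hv, hs])
    (fun x hx => by obtain ⟨i, hi, rfl⟩ := Finset.mem_image.1 hx; exact hmem i hi)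
    (fun x hx => by
      obtain ⟨i, hi, rfl⟩ := Finset.mem_image.1 hx
      simp [hF, heval i hi, hf])
  refine ⟨ξ, hξ, ?_⟩
  have hderiv : (Polynomial.derivative^[n] P).eval ξ = n.factorial * P.coeff n := by
    have hnat : (Polynomial.derivative^[n] P).natDegree = 0 := by
      have h1 := Polynomial.natDegree_iterate_derivative P n
      have h2 : P.natDegree ≤ n := by
        rw [Polynomial.natDegree_le_iff_degree_le]
        rw [hs] at hdeg
        exact Order.le_of_lt_succ (by exact_mod_cast hdeg)
      omega
    rw [Polynomial.eq_C_of_natDegree_eq_zero hnat, Polynomial.eval_C,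
      Polynomial.coeff_iterate_derivative, zero_add, Nat.descFactorial_self, nsmul_eq_mul]
  have hfac : (n.factorial : ℝ) ≠ 0 := by positivity
  rw [eq_div_iff hfac]
  have h1 : (A * (W ^ n * Complex.exp (W * ξ))).re = n.factorial * P.coeff n := by
    rw [← hderiv]; simpa [hF, sub_eq_zero] using h0
  rw [h1, mul_comm]
  congr 1
  rw [hs, Nat.add_sub_cancel] at hcoeff
  rw [hcoeff, expDivDiff, Finset.mul_sum, Complex.re_sum]
  refine Finset.sum_congr rfl fun i hi => ?_
  rw [heval i hi, mul_left_comm, Complex.re_ofReal_mul, div_eq_inv_mul]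

/-- Divided differences of exponentials are bounded like the corresponding derivative. -/
lemma norm_expDivDiff_le {ι : Type*} [DecidableEq ι] {s : Finset ι} {n : ℕ} (hs : s.card = n + 1)
    {v : ι → ℝ} (hv : Set.InjOn v s) (W : ℂ) {R : ℝ} (hmem : ∀ i ∈ s, |v i| ≤ R) :
    ‖expDivDiff s v W‖ ≤ 2 * (‖W‖ ^ n * Real.exp (|W.re| * R)) := by
  have key : ∀ A : ℂ, ‖A‖ = 1 →
      |(A * expDivDiff s v W).re| ≤ ‖W‖ ^ n * Real.exp (|W.re| * R) := by
    intro A hA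
    obtain ⟨ξ, hξ, h⟩ := exists_re_expDivDiff hs hv A W (lo := -R) (hi := R)
      (fun i hi => abs_le.1 (hmem i hi))
    rw [h, abs_div]
    have h1 : |(A * (W ^ n * Complex.exp (W * ξ))).re| ≤ ‖W‖ ^ n * Real.exp (|W.re| * R) := by
      refine (Complex.abs_re_le_norm _).trans ?_
      rw [norm_mul, hA, one_mul, norm_mul, norm_pow, Complex.norm_exp]
      gcongr
      have h2 : (W * (ξ : ℂ)).re = W.re * ξ := by simp
      rw [h2]
      refine (le_abs_self _).trans ?_
      rw [abs_mul]
      gcongr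
      exact abs_le.2 hξ
    have h3 : (1 : ℝ) ≤ |(n.factorial : ℝ)| := by
      rw [Nat.abs_cast]; exact_mod_cast n.factorial_pos
    exact (div_le_self (abs_nonneg _) h3).trans h1
  have h1 := key 1 (by simp)
  have h2 := key (-Complex.I) (by simp)
  have h3 : (-Complex.I * expDivDiff s v W).re = (expDivDiff s v W).im := by simp
  rw [h3] at h2
  rw [one_mul] at h1
  linarith [Complex.norm_le_abs_re_add_abs_im (expDivDiff s v W)]

/-- Divided differences of exponentials at merging nodes converge to the derivative. -/
lemma tendsto_expDivDiff {ι : Type*} [DecidableEq ι] {s : Finset ι} {n : ℕ} (hs : s.card = n + 1)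
    {v : ℕ → ι → ℝ} (hv : ∀ᶠ T in atTop, Set.InjOn (v T) s) (W : ℂ) {α : ℝ}
    (hlim : ∀ i ∈ s, Tendsto (fun T => v T i) atTop (𝓝 α)) :
    Tendsto (fun T => expDivDiff s (v T) W) atTop
      (𝓝 (W ^ n * Complex.exp (W * α) / n.factorial)) := by
  have key : ∀ A : ℂ, Tendsto (fun T => (A * expDivDiff s (v T) W).re) atTop
      (𝓝 ((A * (W ^ n * Complex.exp (W * α))).re / n.factorial)) := by
    intro A
    set g : ℝ → ℝ := fun ξ => (A * (W ^ n * Complex.exp (W * ξ))).re / n.factorial with hg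
    have hgc : Continuous g := by fun_prop
    rw [Metric.tendsto_nhds]
    intro ε hε
    obtain ⟨δ, hδ, hgδ⟩ := Metric.continuousAt_iff.1 (hgc.continuousAt (x := α)) ε hε
    have h1 : ∀ᶠ T in atTop, ∀ i ∈ s, v T i ∈ Set.Icc (α - δ / 2) (α + δ / 2) :=
      (Finset.eventually_all s).2 fun i hi =>
        (hlim i hi).eventually (Icc_mem_nhds (by linarith) (by linarith))
    filter_upwards [h1, hv] with T hT hvT
    obtain ⟨ξ, hξ, h⟩ := exists_re_expDivDiff hs hvT A W hT
    rw [h]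
    refine hgδ ?_
    rw [Real.dist_eq, abs_lt]
    exact ⟨by linarith [hξ.1], by linarith [hξ.2]⟩
  have h1 := key 1
  have h2 := key (-Complex.I)
  have h3 : ∀ w : ℂ, (-Complex.I * w).re = w.im := fun w => by simp
  simp only [h3, one_mul] at h1 h2
  have h4 := ((Complex.continuous_ofReal.tendsto _).comp h1).add
    (((Complex.continuous_ofReal.tendsto _).comp h2).mul_const Complex.I)
  refine (h4.congr fun T => ?_).trans (le_of_eq ?_)
  · simp [Function.comp, Complex.re_add_im]
  · congr 1
    push_cast
    rw [div_mul_eq_mul_div, ← add_div, Complex.re_add_im]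

/-! ### Binomial weights as tilted Fourier integrals -/

/-- The binomial weight `C(m, l) p^l (1 - p)^(m - l)` for an integer `l`. -/
noncomputable def binomWeight (p : ℝ) (m : ℕ) (l : ℤ) : ℝ :=
  intChoose m l * p ^ l * (1 - p) ^ ((m : ℤ) - l)

lemma integral_exp_int_mul (n : ℤ) :
    ∫ θ in (-Real.pi)..Real.pi, Complex.exp (n * (θ * Complex.I)) =
      if n = 0 then 2 * (Real.pi : ℂ) else 0 := by
  split_ifs with h
  · subst h
    simp
    ring
  · have hc : (n : ℂ) * Complex.I ≠ 0 := mul_ne_zero (by exact_mod_cast h) Complex.I_ne_zero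
    have h1 := integral_exp_mul_complex (a := -Real.pi) (b := Real.pi) hc
    have h2 : ∀ θ : ℝ, Complex.exp (n * (θ * Complex.I)) = Complex.exp (n * Complex.I * θ) :=
      fun θ => by congr 1; ring
    simp only [h2, h1]
    have h3 : Complex.exp (n * Complex.I * (Real.pi : ℝ)) =
        Complex.exp (n * Complex.I * ((-Real.pi : ℝ) : ℂ)) := by
      rw [Complex.exp_eq_exp_iff_exists_int]
      exact ⟨n, by push_cast; ring⟩
    rw [h3, sub_self, zero_div]

/-- Fourier inversion for the binomial weights, with an arbitrary exponential tilt `u`. -/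
lemma integral_binomial (p : ℝ) (m : ℕ) (l : ℤ) (u : ℝ) :
    ∫ θ in (-Real.pi)..Real.pi, (1 - p + p * Complex.exp (u + θ * Complex.I)) ^ m *
        Complex.exp (-((u + θ * Complex.I) * l)) =
      2 * Real.pi * binomWeight p m l := by
  have h1 : ∀ θ : ℝ, (1 - p + p * Complex.exp (u + θ * Complex.I)) ^ m *
        Complex.exp (-((u + θ * Complex.I) * l)) =
      ∑ j ∈ Finset.range (m + 1), (((p : ℂ) ^ j * (1 - p) ^ (m - j) * m.choose j) *
        Complex.exp (((j : ℤ) - l : ℤ) * u)) * Complex.exp (((j : ℤ) - l : ℤ) * (θ * Complex.I)) := by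
    intro θ
    rw [add_comm, add_pow, Finset.sum_mul]
    refine Finset.sum_congr rfl fun j _ => ?_
    rw [mul_pow, ← Complex.exp_nat_mul, mul_assoc _ (Complex.exp _) (Complex.exp _),
      ← Complex.exp_add]
    have : Complex.exp (((j : ℤ) - l : ℤ) * u + ((j : ℤ) - l : ℤ) * (θ * Complex.I)) =
      Complex.exp (j * (u + θ * Complex.I)) * Complex.exp (-((u + θ * Complex.I) * l)) := by
      rw [← Complex.exp_add]; congr 1; push_cast; ring
    rw [this]
    ring
  simp only [h1]
  rw [intervalIntegral.integral_finsetSum fun j _ => by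
    apply Continuous.intervalIntegrable; fun_prop]
  simp only [intervalIntegral.integral_const_mul, integral_exp_int_mul]
  by_cases hl : 0 ≤ l ∧ l ≤ m
  · obtain ⟨j, rfl⟩ : ∃ j : ℕ, l = j := ⟨l.toNat, by omega⟩
    have hj : j ≤ m := by omega
    rw [Finset.sum_eq_single_of_mem j (by simp; omega)]
    · have h2 : (m : ℤ) - j = ((m - j : ℕ) : ℤ) := by omega
      simp only [binomWeight, intChoose, h2, zpow_natCast]
      simp
      ring
    · intro i _ hi
      rw [if_neg (by omega), mul_zero]
  · rw [Finset.sum_eq_zero]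
    · have : intChoose m l = 0 := by
        unfold intChoose
        split_ifs with h
        · rw [Nat.choose_eq_zero_of_lt (by omega)]; simp
        · rfl
      simp [binomWeight, this]
    · intro j hj
      have := Finset.mem_range.1 hj
      rw [if_neg (by omega), mul_zero]

/-- The characteristic function of a centred binomial variable with parameters `m` and `p`,
divided by `r`, at the complex argument `W`. -/
noncomputable def centredChar (p : ℝ) (m : ℕ) (r : ℝ) (W : ℂ) : ℂ :=
  ((1 - p + p * Complex.exp (W / r)) * Complex.exp (-(p * (W / r)))) ^ m

lemma integral_centredChar (p : ℝ) (m : ℕ) {r : ℝ} (hr : 0 < r) (l : ℤ) {η : ℝ}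
    (hη : l - p * m = r * η) (U : ℝ) :
    ∫ s in (-(Real.pi * r))..(Real.pi * r), centredChar p m r (U + s * Complex.I) *
        Complex.exp (-((U + s * Complex.I) * η)) =
      2 * Real.pi * (r * binomWeight p m l) := by
  have hr' : (r : ℂ) ≠ 0 := by exact_mod_cast hr.ne'
  have h1 := intervalIntegral.integral_comp_div (a := -(Real.pi * r)) (b := Real.pi * r)
    (fun θ : ℝ => (1 - p + p * Complex.exp ((U / r : ℝ) + θ * Complex.I)) ^ m *
        Complex.exp (-(((U / r : ℝ) + θ * Complex.I) * l))) hr.ne'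
  rw [neg_div, mul_div_cancel_right₀ _ hr.ne', integral_binomial] at h1
  have h2 : (r • (2 * (Real.pi : ℂ) * (binomWeight p m l : ℂ)) : ℂ) =
      2 * Real.pi * (r * binomWeight p m l) := by
    rw [Complex.real_smul]; ring
  rw [← h2, ← h1]
  refine intervalIntegral.integral_congr fun s _ => ?_
  have hl : (l : ℂ) = p * m + r * η := by
    have : (l : ℝ) = p * m + r * η := by linarith
    exact_mod_cast congrArg (fun x : ℝ => (x : ℂ)) this
  have hw : (U + s * Complex.I) / r = ((U / r : ℝ) : ℂ) + ((s / r : ℝ) : ℂ) * Complex.I := by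
    push_cast; field_simp
  simp only [centredChar]
  rw [← hw, mul_pow, ← Complex.exp_nat_mul, mul_assoc, ← Complex.exp_add]
  congr 2
  rw [hl]
  field_simp
  ring

/-- The divided differences of the binomial weights in the starting point, as an integral. -/
lemma integral_centredChar_mul_expDivDiff {ι : Type*} [DecidableEq ι] (p : ℝ) (m : ℕ) {r : ℝ}
    (hr : 0 < r) (z : ℤ) (x : ι → ℤ) (d : ℝ) (s : Finset ι) (U : ℝ) :
    ∫ σ in (-(Real.pi * r))..(Real.pi * r), centredChar p m r (U + σ * Complex.I) *
        Complex.exp (-((U + σ * Complex.I) * (((z - d - p * m) / r : ℝ) : ℂ))) *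
        expDivDiff s (fun i => (x i - d) / r) (U + σ * Complex.I) =
      2 * Real.pi * ((∑ i ∈ s, (∏ j ∈ s.erase i, ((x i - d) / r - (x j - d) / r))⁻¹ *
        (r * binomWeight p m (z - x i)) : ℝ) : ℂ) := by
  have h1 : ∀ σ : ℝ, centredChar p m r (U + σ * Complex.I) *
        Complex.exp (-((U + σ * Complex.I) * (((z - d - p * m) / r : ℝ) : ℂ))) *
        expDivDiff s (fun i => (x i - d) / r) (U + σ * Complex.I) =
      ∑ i ∈ s, ((∏ j ∈ s.erase i, ((x i - d) / r - (x j - d) / r))⁻¹ : ℝ) *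
        (centredChar p m r (U + σ * Complex.I) *
        Complex.exp (-((U + σ * Complex.I) *
          (((z - d - p * m) / r - (x i - d) / r : ℝ) : ℂ)))) := by
    intro σ
    rw [expDivDiff, Finset.mul_sum]
    refine Finset.sum_congr rfl fun i _ => ?_
    have : -((U + σ * Complex.I) * (((z - d - p * m) / r - (x i - d) / r : ℝ) : ℂ)) =
      -((U + σ * Complex.I) * (((z - d - p * m) / r : ℝ) : ℂ)) +
        (U + σ * Complex.I) * (((x i - d) / r : ℝ) : ℂ) := by
      push_cast; ring
    rw [this, Complex.exp_add]
    ring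
  simp only [h1]
  rw [intervalIntegral.integral_finsetSum fun j _ => by
    apply Continuous.intervalIntegrable; unfold centredChar; fun_prop]
  simp only [intervalIntegral.integral_const_mul]
  push_cast
  rw [Finset.mul_sum]
  refine Finset.sum_congr rfl fun i _ => ?_
  have := integral_centredChar p m hr (z - x i)
    (η := (z - d - p * m) / r - (x i - d) / r) (by field_simp; push_cast; ring) U
  push_cast at this ⊢
  rw [this]
  ring

/-! ### The local limit theorem for divided differences -/

/-- The factors of the characteristic function have Gaussian decay on vertical segments. -/
lemma exists_norm_char_le {p : ℝ} (hp : p ∈ Set.Ioo (0 : ℝ) 1) :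
    ∃ κ > 0, ∀ u θ : ℝ, |u| ≤ 1 → |θ| ≤ Real.pi →
      ‖(1 - p + p * Complex.exp (u + θ * Complex.I)) *
        Complex.exp (-(p * (u + θ * Complex.I)))‖ ≤ Real.exp (u ^ 2 - κ * θ ^ 2) := by
  obtain ⟨hp0, hp1⟩ := hp
  have hq : 0 < 1 - p := by linarith
  refine ⟨2 * p * (1 - p) / (Real.pi ^ 2 * Real.exp 3), by positivity, fun u θ hu hθ => ?_⟩
  set κ := 2 * p * (1 - p) / (Real.pi ^ 2 * Real.exp 3) with hκ
  set A := 1 - p + p * Real.exp u with hA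
  have hApos : 0 < A := by positivity
  obtain ⟨hu1, hu2⟩ := abs_le.1 hu
  have hAle : A ≤ Real.exp 1 := by
    have h1 : Real.exp u ≤ Real.exp 1 := Real.exp_le_exp.2 hu2
    have h2 : (1 : ℝ) ≤ Real.exp 1 := Real.one_le_exp zero_le_one
    nlinarith
  -- the real factor is controlled by the second order Taylor expansion
  have hAu : A * Real.exp (-(p * u)) ≤ Real.exp (u ^ 2) := by
    have h1 : A * Real.exp (-(p * u)) =
        (1 - p) * Real.exp (-(p * u)) + p * Real.exp ((1 - p) * u) := by
      have : Real.exp ((1 - p) * u) = Real.exp u * Real.exp (-(p * u)) := by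
        rw [← Real.exp_add]; congr 1; ring
      rw [this, hA]; ring
    have h2 := (abs_le.1 (Real.abs_exp_sub_one_sub_id_le (x := -(p * u)) (by
      rw [abs_neg, abs_mul, abs_of_pos hp0]
      exact mul_le_one₀ hp1.le (abs_nonneg _) hu))).2
    have h3 := (abs_le.1 (Real.abs_exp_sub_one_sub_id_le (x := (1 - p) * u) (by
      rw [abs_mul, abs_of_pos hq]
      exact mul_le_one₀ (by linarith) (abs_nonneg _) hu))).2
    have h4 := Real.add_one_le_exp (u ^ 2)
    rw [h1]
    have h5 : (1 - p) * Real.exp (-(p * u)) ≤ (1 - p) * (1 - p * u + (p * u) ^ 2) := by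
      gcongr; nlinarith
    have h6 : p * Real.exp ((1 - p) * u) ≤ p * (1 + (1 - p) * u + ((1 - p) * u) ^ 2) := by
      gcongr; nlinarith
    have h7 : p * (1 - p) * u ^ 2 ≤ u ^ 2 := by
      have : p * (1 - p) ≤ 1 := by nlinarith
      nlinarith [sq_nonneg u]
    nlinarith
  have hnorm : ‖(1 - p + p * Complex.exp (u + θ * Complex.I) : ℂ)‖ ^ 2 =
      A ^ 2 - 2 * p * (1 - p) * Real.exp u * (1 - Real.cos θ) := by
    rw [← Complex.normSq_eq_norm_sq, Complex.normSq_apply]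
    have h1 : (1 - p + p * Complex.exp (u + θ * Complex.I) : ℂ).re =
        1 - p + p * (Real.exp u * Real.cos θ) := by
      simp [Complex.exp_re]
    have h2 : (1 - p + p * Complex.exp (u + θ * Complex.I) : ℂ).im =
        p * (Real.exp u * Real.sin θ) := by
      simp [Complex.exp_im]
    rw [h1, h2, hA]
    linear_combination (p * Real.exp u) ^ 2 * Real.sin_sq_add_cos_sq θ
  have hbound : ‖(1 - p + p * Complex.exp (u + θ * Complex.I) : ℂ)‖ ≤
      A * Real.exp (-(κ * θ ^ 2)) := by
    refine abs_le_of_sq_le_sq' ?_ (by positivity) |>.2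
    rw [hnorm, mul_pow, ← Real.exp_nat_mul]
    have h1 := Real.cos_le_one_sub_mul_cos_sq hθ
    have h2 := Real.add_one_le_exp (((2 : ℕ) : ℝ) * -(κ * θ ^ 2))
    have h3 : A ^ 2 * (2 * (κ * θ ^ 2)) ≤
        2 * p * (1 - p) * Real.exp u * (2 / Real.pi ^ 2 * θ ^ 2) := by
      have h4 : A ^ 2 ≤ Real.exp 3 * Real.exp u := by
        calc A ^ 2 ≤ Real.exp 1 ^ 2 := by gcongr
          _ = Real.exp 3 * Real.exp (-1) := by
            rw [← Real.exp_nat_mul, ← Real.exp_add]; norm_num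
          _ ≤ _ := by gcongr
      calc A ^ 2 * (2 * (κ * θ ^ 2)) ≤ Real.exp 3 * Real.exp u * (2 * (κ * θ ^ 2)) := by
            gcongr
        _ = _ := by
            rw [hκ]; field_simp
    have h5 : 2 * p * (1 - p) * Real.exp u * (2 / Real.pi ^ 2 * θ ^ 2) ≤
        2 * p * (1 - p) * Real.exp u * (1 - Real.cos θ) := by
      gcongr; linarith
    have h6 : A ^ 2 * (((2 : ℕ) : ℝ) * -(κ * θ ^ 2) + 1) ≤
        A ^ 2 * Real.exp (((2 : ℕ) : ℝ) * -(κ * θ ^ 2)) := by gcongr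
    push_cast at h6 ⊢
    linarith
  have hexp : ‖Complex.exp (-(p * (u + θ * Complex.I)))‖ = Real.exp (-(p * u)) := by
    rw [Complex.norm_exp]; congr 1; simp
  rw [norm_mul, hexp]
  calc _ ≤ A * Real.exp (-(κ * θ ^ 2)) * Real.exp (-(p * u)) := by gcongr
    _ = A * Real.exp (-(p * u)) * Real.exp (-(κ * θ ^ 2)) := by ring
    _ ≤ Real.exp (u ^ 2) * Real.exp (-(κ * θ ^ 2)) := by gcongr
    _ = _ := by rw [← Real.exp_add]; rfl

lemma tendsto_mul_exp_sub_one_sub_id (V : ℂ) :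
    Tendsto (fun T : ℕ => (T : ℂ) * (Complex.exp (V / √(T : ℝ)) - 1 - V / √(T : ℝ))) atTop
      (𝓝 (V ^ 2 / 2)) := by
  rw [tendsto_iff_norm_sub_tendsto_zero]
  have hsqrt : Tendsto (fun T : ℕ => √(T : ℝ)) atTop atTop :=
    Real.tendsto_sqrt_atTop.comp tendsto_natCast_atTop_atTop
  have hlim : Tendsto (fun T : ℕ => ‖V‖ ^ 3 * Real.exp ‖V‖ / √(T : ℝ)) atTop (𝓝 0) :=
    tendsto_const_nhds.div_atTop hsqrt
  refine squeeze_zero' (Eventually.of_forall fun _ => norm_nonneg _) ?_ hlim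
  filter_upwards [eventually_ge_atTop 1] with T hT
  have hT1 : (1 : ℝ) ≤ √(T : ℝ) := Real.one_le_sqrt.2 (by exact_mod_cast hT)
  set r := √(T : ℝ) with hr
  have hr0 : 0 < r := by linarith
  have hrc : (r : ℂ) ≠ 0 := by exact_mod_cast hr0.ne'
  have hTr : (T : ℂ) = (r : ℂ) ^ 2 := by
    have : (T : ℝ) = r ^ 2 := (Real.sq_sqrt (Nat.cast_nonneg T)).symm
    exact_mod_cast congrArg (fun x : ℝ => (x : ℂ)) this
  have h1 := Complex.norm_exp_sub_sum_le_norm_mul_exp (V / r) 3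
  have he : ∑ i ∈ Finset.range 3, (V / r) ^ i / (i.factorial : ℂ) =
      1 + V / r + (V / r) ^ 2 / 2 := by
    simp [Finset.sum_range_succ, Nat.factorial]
  rw [he] at h1
  have h2 : (T : ℂ) * (Complex.exp (V / r) - 1 - V / r) - V ^ 2 / 2 =
      (r : ℂ) ^ 2 * (Complex.exp (V / r) - (1 + V / r + (V / r) ^ 2 / 2)) := by
    rw [hTr]; field_simp; ring
  rw [h2, norm_mul, norm_pow, Complex.norm_real, Real.norm_eq_abs, abs_of_pos hr0]
  have h3 : ‖V / r‖ = ‖V‖ / r := by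
    rw [norm_div, Complex.norm_real, Real.norm_eq_abs, abs_of_pos hr0]
  rw [h3] at h1
  have h4 : Real.exp (‖V‖ / r) ≤ Real.exp ‖V‖ :=
    Real.exp_le_exp.2 (div_le_self (norm_nonneg _) hT1)
  calc _ ≤ r ^ 2 * ((‖V‖ / r) ^ 3 * Real.exp (‖V‖ / r)) := by gcongr
    _ ≤ r ^ 2 * ((‖V‖ / r) ^ 3 * Real.exp ‖V‖) := by gcongr
    _ = _ := by field_simp

/-- Second order Taylor expansion of the characteristic function of a centred Bernoulli
variable. -/
lemma tendsto_char_sub_one (p : ℝ) (W : ℂ) :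
    Tendsto (fun T : ℕ => (T : ℂ) * ((1 - p + p * Complex.exp (W / √(T : ℝ))) *
      Complex.exp (-(p * (W / √(T : ℝ)))) - 1)) atTop (𝓝 (p * (1 - p) * W ^ 2 / 2)) := by
  have h1 := (tendsto_mul_exp_sub_one_sub_id (-(p * W))).const_mul (1 - p : ℂ)
  have h2 := (tendsto_mul_exp_sub_one_sub_id ((1 - p) * W)).const_mul (p : ℂ)
  refine ((h1.add h2).congr fun T => ?_).trans (le_of_eq (by congr 1; ring))
  set w : ℂ := W / √(T : ℝ) with hw
  have e1 : -(p * W) / (√(T : ℝ) : ℂ) = -(p * w) := by rw [hw]; ring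
  have e2 : (1 - p) * W / (√(T : ℝ) : ℂ) = (1 - p) * w := by rw [hw]; ring
  have e3 : Complex.exp ((1 - p) * w) = Complex.exp w * Complex.exp (-(p * w)) := by
    rw [← Complex.exp_add]; congr 1; ring
  rw [e1, e2, e3]
  ring

lemma tendsto_centredChar (p : ℝ) {m : ℕ → ℕ} {τ : ℝ}
    (hm : Tendsto (fun T : ℕ => (m T : ℝ) / T) atTop (𝓝 τ)) (W : ℂ) :
    Tendsto (fun T : ℕ => centredChar p (m T) (√(T : ℝ)) W) atTop
      (𝓝 (Complex.exp (τ * (p * (1 - p)) * W ^ 2 / 2))) := by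
  set g : ℕ → ℂ := fun T => (1 - p + p * Complex.exp (W / √(T : ℝ))) *
      Complex.exp (-(p * (W / √(T : ℝ)))) - 1 with hg
  have h1 : Tendsto (fun T : ℕ => (T : ℂ) * g T) atTop (𝓝 (p * (1 - p) * W ^ 2 / 2)) :=
    tendsto_char_sub_one p W
  have h2 := Complex.tendsto_nat_mul_log_one_add_of_tendsto h1
  have hg0 : Tendsto g atTop (𝓝 0) := by
    have h3 : Tendsto (fun T : ℕ => ((T : ℂ))⁻¹) atTop (𝓝 0) := tendsto_inv_atTop_nhds_zero_nat
    have h4 := h3.mul h1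
    rw [zero_mul] at h4
    refine h4.congr' ?_
    filter_upwards [eventually_ge_atTop 1] with T hT
    have : (T : ℂ) ≠ 0 := by exact_mod_cast (by omega : T ≠ 0)
    exact inv_mul_cancel_left₀ this _
  have hne : ∀ᶠ T in atTop, 1 + g T ≠ 0 := by
    have h3 : Tendsto (fun T => 1 + g T) atTop (𝓝 (1 + 0)) := hg0.const_add 1
    exact h3.eventually_ne (by simp)
  have h5 : Tendsto (fun T : ℕ => (((m T : ℝ) / T : ℝ) : ℂ)) atTop (𝓝 τ) :=
    (Complex.continuous_ofReal.tendsto _).comp hm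
  have h6 := (Complex.continuous_exp.tendsto _).comp (h5.mul h2)
  refine (h6.congr' ?_).trans (le_of_eq (by congr 2; ring))
  filter_upwards [hne, eventually_ge_atTop 1] with T hT hT1
  have hT0 : (T : ℂ) ≠ 0 := by exact_mod_cast (by omega : T ≠ 0)
  have h7 : centredChar p (m T) (√(T : ℝ)) W = (1 + g T) ^ m T := by
    simp only [centredChar, hg]; congr 1; ring
  rw [h7, Function.comp]
  nth_rewrite 2 [← Complex.exp_log hT]
  rw [← Complex.exp_nat_mul]
  congr 1
  push_cast
  field_simp

/-- Uniform Gaussian domination of the integrands, for tilts and nodes in a bounded set and all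
large `T`. -/
lemma exists_norm_integrand_le {ι : Type*} [DecidableEq ι] {p : ℝ} (hp : p ∈ Set.Ioo (0 : ℝ) 1)
    {m : ℕ → ℕ} (hmT : ∀ T, m T ≤ T) {τ : ℝ} (hτ : 0 < τ)
    (hm : Tendsto (fun T : ℕ => (m T : ℝ) / T) atTop (𝓝 τ)) {s : Finset ι} {n : ℕ}
    (hs : s.card = n + 1) (R : ℝ) (hR : 0 ≤ R) :
    ∃ κ > 0, ∃ C ≥ 0, ∀ᶠ T : ℕ in atTop, ∀ U, |U| ≤ R → ∀ σ, |σ| ≤ Real.pi * √(T : ℝ) →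
      ∀ v : ι → ℝ, Set.InjOn v s → (∀ i ∈ s, |v i| ≤ R) → ∀ η : ℝ,
      ‖centredChar p (m T) (√(T : ℝ)) (U + σ * Complex.I) *
        Complex.exp (-((U + σ * Complex.I) * η)) * expDivDiff s v (U + σ * Complex.I)‖ ≤
      C * Real.exp (-(U * η)) * Real.exp (-κ * σ ^ 2) := by
  obtain ⟨κ, hκ, hchar⟩ := exists_norm_char_le hp
  set κ₁ := κ * (τ / 2) with hκ₁
  have hκ₁pos : 0 < κ₁ := by positivity
  refine ⟨κ₁ / 2, by positivity, Real.exp (R ^ 2) *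
    (2 * (n.factorial * Real.exp (R + 1 / (2 * κ₁)) * Real.exp (R * R))), by positivity, ?_⟩
  have hlarge : ∀ᶠ T : ℕ in atTop, R ≤ √(T : ℝ) :=
    (Real.tendsto_sqrt_atTop.comp tendsto_natCast_atTop_atTop).eventually_ge_atTop R
  filter_upwards [hm.eventually (lt_mem_nhds (half_lt_self hτ)), hlarge,
    eventually_ge_atTop 1] with T hT hRT hT1 U hU σ hσ v hv hvR η
  set r := √(T : ℝ) with hr
  have hr0 : 0 < r := Real.sqrt_pos.2 (by exact_mod_cast hT1)
  have hT0 : (0 : ℝ) < T := by exact_mod_cast hT1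
  have hrT : r ^ 2 = T := Real.sq_sqrt (Nat.cast_nonneg T)
  have hΦ : ‖centredChar p (m T) r (U + σ * Complex.I)‖ ≤
      Real.exp (R ^ 2) * Real.exp (-κ₁ * σ ^ 2) := by
    have h1 := hchar (U / r) (σ / r)
      (by rw [abs_div, abs_of_pos hr0]; exact div_le_one_of_le₀ (hU.trans hRT) hr0.le)
      (by rw [abs_div, abs_of_pos hr0]; exact (div_le_iff₀ hr0).2 hσ)
    have hw : (U + σ * Complex.I) / r = ((U / r : ℝ) : ℂ) + ((σ / r : ℝ) : ℂ) * Complex.I := by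
      push_cast; field_simp
    rw [centredChar, hw, norm_pow]
    refine (pow_le_pow_left₀ (norm_nonneg _) h1 _).trans ?_
    rw [← Real.exp_nat_mul, ← Real.exp_add, Real.exp_le_exp, div_pow, div_pow, hrT]
    have h2 : (m T : ℝ) / T ≤ 1 := div_le_one_of_le₀ (by exact_mod_cast hmT T) hT0.le
    have h3 : (m T : ℝ) / T * U ^ 2 ≤ R ^ 2 := by
      have h4 : U ^ 2 ≤ R ^ 2 := sq_le_sq' (by linarith [(abs_le.1 hU).1]) (abs_le.1 hU).2
      calc _ ≤ 1 * U ^ 2 := by gcongr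
        _ ≤ _ := by linarith
    have h5 : κ₁ * σ ^ 2 ≤ κ * ((m T : ℝ) / T) * σ ^ 2 := by rw [hκ₁]; gcongr
    have h6 : (m T : ℝ) * (U ^ 2 / T - κ * (σ ^ 2 / T)) =
        (m T : ℝ) / T * U ^ 2 - κ * ((m T : ℝ) / T) * σ ^ 2 := by field_simp
    rw [h6]
    linarith
  have hre : (U + σ * Complex.I : ℂ).re = U := by simp
  have hexp : ‖Complex.exp (-((U + σ * Complex.I) * η))‖ = Real.exp (-(U * η)) := by
    rw [Complex.norm_exp]; congr 1; simp
  have hdd : ‖expDivDiff s v (U + σ * Complex.I)‖ ≤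
      2 * (n.factorial * Real.exp (R + 1 / (2 * κ₁)) * Real.exp (R * R)) *
        Real.exp (κ₁ / 2 * σ ^ 2) := by
    refine (norm_expDivDiff_le hs hv _ hvR).trans ?_
    rw [hre]
    have h1 : ‖(U + σ * Complex.I : ℂ)‖ ≤ R + |σ| := by
      refine (norm_add_le _ _).trans ?_
      simp only [norm_mul, Complex.norm_real, Complex.norm_I, mul_one, Real.norm_eq_abs]
      gcongr
    have h2 : (R + |σ|) ^ n ≤ n.factorial * Real.exp (R + |σ|) := by
      have := Real.pow_div_factorial_le_exp (R + |σ|) (by positivity) n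
      rwa [div_le_iff₀ (by positivity), mul_comm] at this
    -- the linear exponent `|σ|` is absorbed by half of the Gaussian decay
    have h3 : |σ| ≤ 1 / (2 * κ₁) + κ₁ / 2 * σ ^ 2 := by
      have h4 : 0 ≤ (κ₁ * |σ| - 1) ^ 2 / (2 * κ₁) := by positivity
      have h5 : (κ₁ * |σ| - 1) ^ 2 / (2 * κ₁) = 1 / (2 * κ₁) + κ₁ / 2 * σ ^ 2 - |σ| := by
        rw [← sq_abs σ]; field_simp; ring
      linarith
    calc 2 * (‖(U + σ * Complex.I : ℂ)‖ ^ n * Real.exp (|U| * R))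
        ≤ 2 * ((n.factorial * Real.exp (R + (1 / (2 * κ₁) + κ₁ / 2 * σ ^ 2))) *
          Real.exp (R * R)) := by
          gcongr
          calc _ ≤ (R + |σ|) ^ n := by gcongr
            _ ≤ _ := h2
            _ ≤ _ := by gcongr
      _ = _ := by rw [← add_assoc, Real.exp_add]; ring
  rw [norm_mul, norm_mul, hexp]
  calc _ ≤ (Real.exp (R ^ 2) * Real.exp (-κ₁ * σ ^ 2)) * Real.exp (-(U * η)) *
        (2 * (n.factorial * Real.exp (R + 1 / (2 * κ₁)) * Real.exp (R * R)) *
        Real.exp (κ₁ / 2 * σ ^ 2)) := by gcongr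
    _ = Real.exp (R ^ 2) *
          (2 * (n.factorial * Real.exp (R + 1 / (2 * κ₁)) * Real.exp (R * R))) *
          Real.exp (-(U * η)) * (Real.exp (-κ₁ * σ ^ 2) * Real.exp (κ₁ / 2 * σ ^ 2)) := by ring
    _ = _ := by rw [← Real.exp_add]; congr 2; ring

/-- Exponential decay of the divided differences of the binomial weights, from a tilt by `±1`. -/
lemma exists_norm_integral_le {ι : Type*} [DecidableEq ι] {p : ℝ} (hp : p ∈ Set.Ioo (0 : ℝ) 1)
    {m : ℕ → ℕ} (hmT : ∀ T, m T ≤ T) {τ : ℝ} (hτ : 0 < τ)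
    (hm : Tendsto (fun T : ℕ => (m T : ℝ) / T) atTop (𝓝 τ)) {s : Finset ι} {n : ℕ}
    (hs : s.card = n + 1) (R : ℝ) (hR : 1 ≤ R) :
    ∃ C ≥ 0, ∀ᶠ T : ℕ in atTop, ∀ v : ι → ℝ, Set.InjOn v s → (∀ i ∈ s, |v i| ≤ R) → ∀ η : ℝ,
      ∃ U : ℝ, ‖∫ σ in (-(Real.pi * √(T : ℝ)))..(Real.pi * √(T : ℝ)),
        centredChar p (m T) (√(T : ℝ)) (U + σ * Complex.I) *
        Complex.exp (-((U + σ * Complex.I) * η)) * expDivDiff s v (U + σ * Complex.I)‖ ≤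
      C * Real.exp (-|η|) := by
  obtain ⟨κ, hκ, C, hC, h⟩ := exists_norm_integrand_le hp hmT hτ hm hs R (by linarith)
  refine ⟨C * ∫ σ : ℝ, Real.exp (-κ * σ ^ 2), mul_nonneg hC
    (integral_nonneg fun _ => (Real.exp_pos _).le), ?_⟩
  filter_upwards [h] with T hT v hv hvR η
  obtain ⟨U, hU, hUη⟩ : ∃ U : ℝ, |U| ≤ R ∧ U * η = |η| := by
    rcases le_total 0 η with h0 | h0
    · exact ⟨1, by simpa using hR, by rw [abs_of_nonneg h0, one_mul]⟩
    · exact ⟨-1, by simpa using hR, by rw [abs_of_nonpos h0]; ring⟩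
  refine ⟨U, ?_⟩
  have hpos : 0 ≤ Real.pi * √(T : ℝ) := by positivity
  have hint : Integrable fun σ : ℝ => C * Real.exp (-(U * η)) * Real.exp (-κ * σ ^ 2) :=
    (integrable_exp_neg_mul_sq hκ).const_mul _
  refine (intervalIntegral.norm_integral_le_of_norm_le (by linarith)
    (ae_of_all _ fun σ hσ => hT U hU σ (abs_le.2 ⟨hσ.1.le, hσ.2⟩) v hv hvR η)
    hint.intervalIntegrable).trans ?_
  rw [intervalIntegral.integral_of_le (by linarith)]
  refine (setIntegral_le_integral hint (ae_of_all _ fun σ => by positivity)).trans ?_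
  rw [integral_const_mul, hUη]
  exact le_of_eq (by ring)

/-- The limit of the integrals representing the divided differences, on a fixed vertical line; the
nodes `v T i` merge at `α`. -/
lemma tendsto_integral_centredChar {ι : Type*} [DecidableEq ι] {p : ℝ}
    (hp : p ∈ Set.Ioo (0 : ℝ) 1) {m : ℕ → ℕ} (hmT : ∀ T, m T ≤ T) {τ : ℝ} (hτ : 0 < τ)
    (hm : Tendsto (fun T : ℕ => (m T : ℝ) / T) atTop (𝓝 τ)) {s : Finset ι} {n : ℕ}
    (hs : s.card = n + 1) {v : ℕ → ι → ℝ} (hv : ∀ᶠ T in atTop, Set.InjOn (v T) s) {α : ℝ}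
    (hlim : ∀ i ∈ s, Tendsto (fun T => v T i) atTop (𝓝 α)) {η : ℕ → ℝ} {ζ : ℝ}
    (hη : Tendsto η atTop (𝓝 ζ)) (U : ℝ) :
    Tendsto (fun T : ℕ => ∫ σ in (-(Real.pi * √(T : ℝ)))..(Real.pi * √(T : ℝ)),
        centredChar p (m T) (√(T : ℝ)) (U + σ * Complex.I) *
        Complex.exp (-((U + σ * Complex.I) * η T)) * expDivDiff s (v T) (U + σ * Complex.I)) atTop
      (𝓝 (∫ σ : ℝ, Complex.exp (τ * (p * (1 - p)) * (U + σ * Complex.I) ^ 2 / 2) *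
        Complex.exp (-((U + σ * Complex.I) * ζ)) *
        ((U + σ * Complex.I) ^ n * Complex.exp ((U + σ * Complex.I) * α) / n.factorial))) := by
  set R := max |U| (|α| + 1) with hRdef
  obtain ⟨κ, hκ, C, hC, h⟩ := exists_norm_integrand_le hp hmT hτ hm hs R (by positivity)
  have hvR : ∀ᶠ T in atTop, ∀ i ∈ s, |v T i| ≤ R :=
    (Finset.eventually_all s).2 fun i hi => by
      have := (hlim i hi).abs.eventually (gt_mem_nhds (lt_add_one |α|))
      filter_upwards [this] with T hT
      exact hT.le.trans (le_max_right _ _)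
  have hηb : ∀ᶠ T in atTop, -(U * η T) < -(U * ζ) + 1 :=
    (hη.const_mul U).neg.eventually (gt_mem_nhds (lt_add_one _))
  have hpos : ∀ T : ℕ, -(Real.pi * √(T : ℝ)) ≤ Real.pi * √(T : ℝ) := fun T => by
    have : 0 ≤ Real.pi * √(T : ℝ) := by positivity
    linarith
  refine Tendsto.congr (fun T => ((intervalIntegral.integral_of_le (hpos T)).trans
    (integral_indicator measurableSet_Ioc).symm).symm) ?_
  refine tendsto_integral_filter_of_dominated_convergence
    (fun σ => C * Real.exp (-(U * ζ) + 1) * Real.exp (-κ * σ ^ 2)) ?_ ?_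
    ((integrable_exp_neg_mul_sq hκ).const_mul _) ?_
  · refine Eventually.of_forall fun T => ?_
    refine (Continuous.aestronglyMeasurable ?_).indicator measurableSet_Ioc
    unfold centredChar expDivDiff
    fun_prop
  · filter_upwards [h, hvR, hηb, hv] with T hT hvT hηT hinj
    refine ae_of_all _ fun σ => ?_
    by_cases hσ : σ ∈ Set.Ioc (-(Real.pi * √(T : ℝ))) (Real.pi * √(T : ℝ))
    · rw [Set.indicator_of_mem hσ]
      refine (hT U (le_max_left _ _) σ (abs_le.2 ⟨hσ.1.le, hσ.2⟩) _ hinj hvT (η T)).trans ?_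
      gcongr
    · rw [Set.indicator_of_notMem hσ, norm_zero]
      positivity
  · refine ae_of_all _ fun σ => ?_
    have hbig : ∀ᶠ T : ℕ in atTop, σ ∈ Set.Ioc (-(Real.pi * √(T : ℝ))) (Real.pi * √(T : ℝ)) := by
      have : Tendsto (fun T : ℕ => Real.pi * √(T : ℝ)) atTop atTop :=
        (Real.tendsto_sqrt_atTop.comp tendsto_natCast_atTop_atTop).const_mul_atTop Real.pi_pos
      filter_upwards [this.eventually_gt_atTop |σ|] with T hT
      exact ⟨by linarith [neg_abs_le σ], (le_abs_self σ).trans hT.le⟩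
    have h1 := tendsto_centredChar p hm (U + σ * Complex.I)
    have h2 : Tendsto (fun T => Complex.exp (-((U + σ * Complex.I) * η T))) atTop
        (𝓝 (Complex.exp (-((U + σ * Complex.I) * ζ)))) := by
      have hc : Continuous fun x : ℝ => Complex.exp (-((U + σ * Complex.I) * x)) := by fun_prop
      exact (hc.tendsto ζ).comp hη
    have h3 := tendsto_expDivDiff hs hv (U + σ * Complex.I) hlim
    refine ((h1.mul h2).mul h3).congr' ?_
    filter_upwards [hbig] with T hT
    rw [Set.indicator_of_mem hT]

/-! ### Asymptotics of the determinants -/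

/-- The indices up to `i` in the block of equal entries of `a` that contains `i`. -/
noncomputable def blockUpTo {k : ℕ} (a : Fin k → ℝ) (i : Fin k) : Finset (Fin k) :=
  Finset.univ.filter fun l => l ≤ i ∧ a l = a i

lemma mem_blockUpTo {k : ℕ} {a : Fin k → ℝ} {i l : Fin k} :
    l ∈ blockUpTo a i ↔ l ≤ i ∧ a l = a i := by
  simp [blockUpTo]

lemma card_blockUpTo {k : ℕ} (a : Fin k → ℝ) (i : Fin k) :
    (blockUpTo a i).card = blockPosition a i + 1 := by
  have h : blockUpTo a i = insert i (Finset.univ.filter fun i' => i' < i ∧ a i' = a i) := by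
    ext l
    simp only [mem_blockUpTo, Finset.mem_insert, Finset.mem_filter, Finset.mem_univ, true_and,
      le_iff_lt_or_eq]
    constructor
    · rintro ⟨h | h, h'⟩
      · exact Or.inr ⟨h, h'⟩
      · exact Or.inl h
    · rintro (rfl | ⟨h, h'⟩)
      · exact ⟨Or.inr rfl, rfl⟩
      · exact ⟨Or.inl h, h'⟩
  rw [h, Finset.card_insert_of_notMem (by simp), blockPosition]

lemma blockPosition_lt {k : ℕ} {a : Fin k → ℝ} {i l : Fin k} (hl : l < i) (ha : a l = a i) :
    blockPosition a l < blockPosition a i := by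
  have h1 : (blockUpTo a l).card ≤ blockPosition a i := by
    refine Finset.card_le_card fun j hj => ?_
    rw [mem_blockUpTo] at hj
    simpa using ⟨hj.1.trans_lt hl, hj.2.trans ha⟩
  rw [card_blockUpTo] at h1
  omega

/-- Along a block the positions run through an initial segment of `ℕ`. -/
lemma sum_blockUpTo {k : ℕ} (a : Fin k → ℝ) (i : Fin k) {M : Type*} [AddCommMonoid M]
    (g : ℕ → M) :
    ∑ l ∈ blockUpTo a i, g (blockPosition a l) =
      ∑ n ∈ Finset.range (blockPosition a i + 1), g n := by
  have hinj : Set.InjOn (blockPosition a) (blockUpTo a i) := by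
    intro l hl l' hl' h
    simp only [Finset.mem_coe, mem_blockUpTo] at hl hl'
    rcases lt_trichotomy l l' with h1 | h1 | h1
    · exact absurd h (blockPosition_lt h1 (hl.2.trans hl'.2.symm)).ne
    · exact h1
    · exact absurd h (blockPosition_lt h1 (hl'.2.trans hl.2.symm)).ne'
  have himage : (blockUpTo a i).image (blockPosition a) =
      Finset.range (blockPosition a i + 1) := by
    refine Finset.eq_of_subset_of_card_le (fun n hn => ?_) ?_
    · obtain ⟨l, hl, rfl⟩ := Finset.mem_image.1 hn
      rw [mem_blockUpTo] at hl
      rw [Finset.mem_range, Nat.lt_succ_iff]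
      rcases hl.1.lt_or_eq with h | h
      · exact (blockPosition_lt h hl.2).le
      · rw [h]
    · rw [Finset.card_image_of_injOn hinj, card_blockUpTo, Finset.card_range]
  rw [← himage, Finset.sum_image hinj]

/-- The matrix that takes a vector of values at the nodes `ξ` to its divided differences along the
blocks of equal entries of `a`. -/
noncomputable def divDiffMatrix {k : ℕ} (a ξ : Fin k → ℝ) : Matrix (Fin k) (Fin k) ℝ :=
  Matrix.of fun i l =>
    if l ∈ blockUpTo a i then (∏ j ∈ (blockUpTo a i).erase l, (ξ l - ξ j))⁻¹ else 0

lemma det_divDiffMatrix_ne_zero {k : ℕ} (a : Fin k → ℝ) {ξ : Fin k → ℝ}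
    (hξ : Function.Injective ξ) : (divDiffMatrix a ξ).det ≠ 0 := by
  rw [Matrix.det_of_isLowerTriangular]
  · refine Finset.prod_ne_zero_iff.2 fun i _ => ?_
    rw [divDiffMatrix, Matrix.of_apply, if_pos (mem_blockUpTo.2 ⟨le_rfl, rfl⟩)]
    refine inv_ne_zero (Finset.prod_ne_zero_iff.2 fun j hj => sub_ne_zero.2 ?_)
    exact hξ.ne (Finset.ne_of_mem_erase hj).symm
  · intro i l hil
    rw [divDiffMatrix, Matrix.of_apply, if_neg]
    rw [mem_blockUpTo]
    exact fun h => absurd h.1 (not_le.2 hil)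

/-- The determinant of scaled binomial weights `r P(S_m = z_j - x_l)`, in divided differences in
the starting points. -/
noncomputable def scaledDet {k : ℕ} (a : Fin k → ℝ) (p : ℝ) (m : ℕ) (r d : ℝ) (x z : Fin k → ℤ) :
    ℝ :=
  (divDiffMatrix a fun i => (x i - d) / r).det *
    (Matrix.of fun l j => r * binomWeight p m (z j - x l)).det

/-- The entries of the matrix with determinant `scaledDet`. -/
noncomputable def scaledEntry {k : ℕ} (a : Fin k → ℝ) (p : ℝ) (m : ℕ) (r d : ℝ) (x : Fin k → ℤ)
    (i : Fin k) (z : ℤ) : ℝ :=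
  ∑ l ∈ blockUpTo a i, (∏ j ∈ (blockUpTo a i).erase l, ((x l - d) / r - (x j - d) / r))⁻¹ *
    (r * binomWeight p m (z - x l))

lemma scaledDet_eq {k : ℕ} (a : Fin k → ℝ) (p : ℝ) (m : ℕ) (r d : ℝ) (x z : Fin k → ℤ) :
    scaledDet a p m r d x z = (Matrix.of fun i j => scaledEntry a p m r d x i (z j)).det := by
  rw [scaledDet, ← Matrix.det_mul]
  congr 1
  ext i j
  simp only [Matrix.mul_apply, divDiffMatrix, Matrix.of_apply, scaledEntry, ite_mul, zero_mul]
  rw [Finset.sum_ite_mem, Finset.univ_inter]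

lemma scaledEntry_eq_integral {k : ℕ} (a : Fin k → ℝ) (p : ℝ) (m : ℕ) {r : ℝ} (hr : 0 < r) (d : ℝ)
    (x : Fin k → ℤ) (i : Fin k) (z : ℤ) (U : ℝ) :
    (scaledEntry a p m r d x i z : ℂ) = (2 * Real.pi : ℂ)⁻¹ *
      ∫ σ in (-(Real.pi * r))..(Real.pi * r), centredChar p m r (U + σ * Complex.I) *
        Complex.exp (-((U + σ * Complex.I) * (((z - d - p * m) / r : ℝ) : ℂ))) *
        expDivDiff (blockUpTo a i) (fun i => (x i - d) / r) (U + σ * Complex.I) := by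
  have hpi : (2 * Real.pi : ℂ) ≠ 0 := by
    exact mul_ne_zero two_ne_zero (by exact_mod_cast Real.pi_ne_zero)
  rw [integral_centredChar_mul_expDivDiff p m hr, inv_mul_cancel_left₀ hpi, scaledEntry]

/-- The Fourier moments `∫ e^{-v σ² / 2} e^{i σ α} (i σ)^n dσ` of a Gaussian function. -/
noncomputable def gaussMoment (v α : ℝ) (n : ℕ) : ℂ :=
  ∫ σ : ℝ, Complex.exp (-(v / 2) * σ ^ 2) * Complex.exp (σ * Complex.I * α) *
    (σ * Complex.I) ^ n

lemma integrable_gaussMoment {v : ℝ} (hv : 0 < v) (α : ℝ) (n : ℕ) :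
    Integrable fun σ : ℝ => Complex.exp (-(v / 2) * σ ^ 2) * Complex.exp (σ * Complex.I * α) *
      (σ * Complex.I) ^ n := by
  have h := integrable_rpow_mul_exp_neg_mul_sq (b := v / 2) (by positivity) (s := n)
    (by linarith [(Nat.cast_nonneg n : (0 : ℝ) ≤ n)])
  refine h.mono (by fun_prop) (ae_of_all _ fun σ => le_of_eq ?_)
  have h1 : ‖Complex.exp (-(v / 2) * σ ^ 2)‖ = Real.exp (-(v / 2) * σ ^ 2) := by
    rw [Complex.norm_exp]
    have : (-(v / 2) * σ ^ 2 : ℂ) = ((-(v / 2) * σ ^ 2 : ℝ) : ℂ) := by push_cast; ring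
    rw [this, Complex.ofReal_re]
  have h2 : ‖Complex.exp (σ * Complex.I * α)‖ = 1 := by
    rw [Complex.norm_exp]; simp
  rw [norm_mul, norm_mul, h1, h2, mul_one, norm_pow, norm_mul, Complex.norm_I, mul_one,
    Complex.norm_real, norm_mul, Real.rpow_natCast, norm_pow, Real.norm_eq_abs (Real.exp _),
    abs_of_pos (Real.exp_pos _), mul_comm]

lemma exists_gaussMoment_zero {v : ℝ} (hv : 0 < v) (α : ℝ) :
    ∃ g : ℝ, 0 < g ∧ gaussMoment v α 0 = g := by
  refine ⟨(Real.pi / (v / 2)) ^ (1 / 2 : ℝ) * Real.exp (-α ^ 2 / (4 * (v / 2))), by positivity, ?_⟩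
  have h := fourierIntegral_gaussian (b := ((v / 2 : ℝ) : ℂ)) (by
    rw [Complex.ofReal_re]; positivity) α
  rw [Complex.ofReal_mul, Complex.ofReal_cpow (by positivity)]
  push_cast at h ⊢
  rw [← h, gaussMoment]
  refine integral_congr_ae (ae_of_all _ fun σ => ?_)
  simp only [pow_zero, mul_one]
  rw [mul_comm]
  congr 2
  ring

/-- The limiting integral on the contour through the saddle point `ζ / v`. -/
lemma integral_saddle {v : ℝ} (hv : 0 < v) (α ζ : ℝ) (n : ℕ) :
    ∫ σ : ℝ, Complex.exp (v * ((1 / v * ζ : ℝ) + σ * Complex.I) ^ 2 / 2) *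
        Complex.exp (-(((1 / v * ζ : ℝ) + σ * Complex.I) * ζ)) *
        (((1 / v * ζ : ℝ) + σ * Complex.I) ^ n *
          Complex.exp (((1 / v * ζ : ℝ) + σ * Complex.I) * α) / n.factorial) =
      Real.exp (-(1 / v / 2) * ζ ^ 2) * ∑ l ∈ Finset.range (n + 1),
        (n.choose l / n.factorial * gaussMoment v α (n - l)) *
          ((1 / v * ζ) ^ l * Real.exp (1 / v * α * ζ) : ℝ) := by
  have hv' : (v : ℂ) ≠ 0 := by exact_mod_cast hv.ne'
  have h1 : ∀ σ : ℝ, Complex.exp (v * ((1 / v * ζ : ℝ) + σ * Complex.I) ^ 2 / 2) *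
        Complex.exp (-(((1 / v * ζ : ℝ) + σ * Complex.I) * ζ)) *
        (((1 / v * ζ : ℝ) + σ * Complex.I) ^ n *
          Complex.exp (((1 / v * ζ : ℝ) + σ * Complex.I) * α) / n.factorial) =
      ∑ l ∈ Finset.range (n + 1), (Real.exp (-(1 / v / 2) * ζ ^ 2) *
        (n.choose l / n.factorial * ((1 / v * ζ) ^ l * Real.exp (1 / v * α * ζ) : ℝ))) *
        (Complex.exp (-(v / 2) * σ ^ 2) * Complex.exp (σ * Complex.I * α) *
          (σ * Complex.I) ^ (n - l)) := by
    intro σ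
    have h2 : Complex.exp (v * ((1 / v * ζ : ℝ) + σ * Complex.I) ^ 2 / 2) *
        Complex.exp (-(((1 / v * ζ : ℝ) + σ * Complex.I) * ζ)) *
        Complex.exp (((1 / v * ζ : ℝ) + σ * Complex.I) * α) =
        Real.exp (-(1 / v / 2) * ζ ^ 2) * Real.exp (1 / v * α * ζ) *
          (Complex.exp (-(v / 2) * σ ^ 2) * Complex.exp (σ * Complex.I * α)) := by
      rw [Complex.ofReal_exp, Complex.ofReal_exp, ← Complex.exp_add, ← Complex.exp_add,
        ← Complex.exp_add, ← Complex.exp_add, ← Complex.exp_add]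
      congr 1
      push_cast
      field_simp
      linear_combination (v ^ 2 * σ ^ 2 : ℂ) * Complex.I_sq
    calc _ = (Complex.exp (v * ((1 / v * ζ : ℝ) + σ * Complex.I) ^ 2 / 2) *
        Complex.exp (-(((1 / v * ζ : ℝ) + σ * Complex.I) * ζ)) *
        Complex.exp (((1 / v * ζ : ℝ) + σ * Complex.I) * α)) *
        (((1 / v * ζ : ℝ) + σ * Complex.I) ^ n / n.factorial) := by ring
      _ = _ := by
        rw [h2, add_pow, Finset.sum_div, Finset.mul_sum]
        refine Finset.sum_congr rfl fun l _ => ?_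
        push_cast
        ring
  simp only [h1]
  rw [integral_finsetSum _ fun l _ => (integrable_gaussMoment hv α (n - l)).const_mul _]
  simp only [integral_const_mul]
  rw [Finset.mul_sum]
  refine Finset.sum_congr rfl fun l _ => ?_
  rw [gaussMoment]
  ring

/-- The lower triangular matrix that expresses the limits of the divided differences through the
rows of the confluent exponential matrix. -/
noncomputable def gaussMatrix {k : ℕ} (v : ℝ) (a : Fin k → ℝ) : Matrix (Fin k) (Fin k) ℂ :=
  Matrix.of fun i l => if l ∈ blockUpTo a i then
    (2 * Real.pi : ℂ)⁻¹ * ((blockPosition a i).choose (blockPosition a l) /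
      (blockPosition a i).factorial *
        gaussMoment v (a i) (blockPosition a i - blockPosition a l)) else 0

lemma exists_det_gaussMatrix {k : ℕ} {v : ℝ} (hv : 0 < v) (a : Fin k → ℝ) :
    ∃ κ : ℝ, κ ≠ 0 ∧ (gaussMatrix v a).det = κ := by
  choose g hg hgv using fun i => exists_gaussMoment_zero hv (a i)
  refine ⟨∏ i, (2 * Real.pi)⁻¹ * (1 / (blockPosition a i).factorial * g i), ?_, ?_⟩
  · exact Finset.prod_ne_zero_iff.2 fun i _ => by have := hg i; positivity
  · rw [Matrix.det_of_isLowerTriangular]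
    · push_cast
      refine Finset.prod_congr rfl fun i _ => ?_
      rw [gaussMatrix, Matrix.of_apply, if_pos (mem_blockUpTo.2 ⟨le_rfl, rfl⟩), Nat.sub_self,
        hgv, Nat.choose_self]
      push_cast
      ring
    · intro i l hil
      rw [gaussMatrix, Matrix.of_apply, if_neg]
      rw [mem_blockUpTo]
      exact fun h => absurd h.1 (not_le.2 hil)

lemma tendsto_scaledEntry {k : ℕ} {p : ℝ} (hp : p ∈ Set.Ioo (0 : ℝ) 1) {m : ℕ → ℕ}
    (hmT : ∀ T, m T ≤ T) {τ : ℝ} (hτ : 0 < τ)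
    (hm : Tendsto (fun T : ℕ => (m T : ℝ) / T) atTop (𝓝 τ)) {a : Fin k → ℝ} {d : ℕ → ℝ}
    {x : ℕ → Fin k → ℤ} (hx : ∀ T, StrictAnti (x T))
    (hxa : ∀ i, Tendsto (fun T : ℕ => (x T i - d T) / √(T : ℝ)) atTop (𝓝 (a i)))
    {z : ℕ → ℤ} {ζ : ℝ}
    (hz : Tendsto (fun T : ℕ => (z T - d T - p * m T) / √(T : ℝ)) atTop (𝓝 ζ)) (i : Fin k) :
    Tendsto (fun T : ℕ => (scaledEntry a p (m T) (√(T : ℝ)) (d T) (x T) i (z T) : ℂ)) atTop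
      (𝓝 (Real.exp (-(1 / (p * (1 - p) * τ) / 2) * ζ ^ 2) * ∑ l,
        gaussMatrix (p * (1 - p) * τ) a i l * ((1 / (p * (1 - p) * τ) * ζ) ^ blockPosition a l *
          Real.exp (1 / (p * (1 - p) * τ) * a l * ζ) : ℝ))) := by
  have hq : 0 < 1 - p := by linarith [hp.2]
  have hv : 0 < p * (1 - p) * τ := mul_pos (mul_pos hp.1 hq) hτ
  set v := p * (1 - p) * τ with hvdef
  have hinj : ∀ᶠ T : ℕ in atTop,
      Set.InjOn (fun i => (x T i - d T) / √(T : ℝ)) (blockUpTo a i) := by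
    filter_upwards [eventually_ge_atTop 1] with T hT
    have hr : √(T : ℝ) ≠ 0 := (Real.sqrt_pos.2 (by exact_mod_cast hT)).ne'
    intro l _ l' _ h
    have h1 : (x T l : ℝ) = x T l' := by
      have := (div_left_inj' hr).1 h
      linarith
    exact (hx T).injective (by exact_mod_cast h1)
  have h := tendsto_integral_centredChar hp hmT hτ hm (card_blockUpTo a i) hinj (α := a i)
    (fun l hl => by rw [← (mem_blockUpTo.1 hl).2]; exact hxa l) hz (1 / v * ζ)
  have hτv : (τ * (p * (1 - p)) : ℂ) = (v : ℂ) := by rw [hvdef]; push_cast; ring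
  rw [hτv, integral_saddle hv] at h
  refine ((h.const_mul (2 * Real.pi : ℂ)⁻¹).congr' ?_).trans (le_of_eq ?_)
  · filter_upwards [eventually_ge_atTop 1] with T hT
    rw [scaledEntry_eq_integral a p (m T) (Real.sqrt_pos.2 (by exact_mod_cast hT)) (d T) (x T) i
      (z T) (1 / v * ζ)]
  · congr 1
    rw [mul_left_comm]
    congr 1
    rw [← sum_blockUpTo a i fun l => ((blockPosition a i).choose l /
      (blockPosition a i).factorial * gaussMoment v (a i) (blockPosition a i - l)) *
          ((1 / v * ζ) ^ l * Real.exp (1 / v * a i * ζ) : ℝ), Finset.mul_sum]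
    simp only [gaussMatrix, Matrix.of_apply, ite_mul, zero_mul]
    rw [Finset.sum_ite_mem, Finset.univ_inter]
    refine Finset.sum_congr rfl fun l hl => ?_
    rw [(mem_blockUpTo.1 hl).2]
    ring

/-- The local limit theorem for determinants of binomial weights: in divided differences they
converge to a multiple of a Gaussian factor times the confluent exponential determinant. -/
theorem exists_tendsto_scaledDet {k : ℕ} {p : ℝ} (hp : p ∈ Set.Ioo (0 : ℝ) 1) {m : ℕ → ℕ}
    (hmT : ∀ T, m T ≤ T) {τ : ℝ} (hτ : 0 < τ)
    (hm : Tendsto (fun T : ℕ => (m T : ℝ) / T) atTop (𝓝 τ)) {a : Fin k → ℝ} {d : ℕ → ℝ}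
    {x : ℕ → Fin k → ℤ} (hx : ∀ T, StrictAnti (x T))
    (hxa : ∀ i, Tendsto (fun T : ℕ => (x T i - d T) / √(T : ℝ)) atTop (𝓝 (a i))) :
    ∃ κ : ℝ, κ ≠ 0 ∧ ∀ (z : ℕ → Fin k → ℤ) (ζ : Fin k → ℝ),
      (∀ j, Tendsto (fun T : ℕ => (z T j - d T - p * m T) / √(T : ℝ)) atTop (𝓝 (ζ j))) →
      Tendsto (fun T : ℕ => scaledDet a p (m T) (√(T : ℝ)) (d T) (x T) (z T)) atTop
        (𝓝 (κ * ((∏ j, Real.exp (-(1 / (p * (1 - p) * τ) / 2) * ζ j ^ 2)) *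
          confluentDet (1 / (p * (1 - p) * τ)) a ζ))) := by
  have hq : 0 < 1 - p := by linarith [hp.2]
  have hv : 0 < p * (1 - p) * τ := mul_pos (mul_pos hp.1 hq) hτ
  obtain ⟨κ, hκ, hdet⟩ := exists_det_gaussMatrix hv a
  refine ⟨κ, hκ, fun z ζ hz => ?_⟩
  set v := p * (1 - p) * τ with hvdef
  set c := 1 / v with hc
  set M : Matrix (Fin k) (Fin k) ℝ := Matrix.of fun i j =>
    (c * ζ j) ^ blockPosition a i * Real.exp (c * a i * ζ j) with hM
  have hlim : Tendsto (fun T : ℕ => (Matrix.of fun i j =>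
      (scaledEntry a p (m T) (√(T : ℝ)) (d T) (x T) i (z T j) : ℂ)).det) atTop
      (𝓝 (Matrix.of fun i j => (Real.exp (-(c / 2) * ζ j ^ 2) : ℂ) *
        (gaussMatrix v a * M.map Complex.ofReal) i j).det) := by
    refine ((continuous_id.matrix_det).tendsto _).comp ?_
    refine tendsto_pi_nhds.2 fun i => tendsto_pi_nhds.2 fun j => ?_
    exact tendsto_scaledEntry hp hmT hτ hm hx hxa (hz j) i
  rw [Matrix.det_mul_row, Matrix.det_mul, hdet] at hlim
  have hofReal : ∀ N : Matrix (Fin k) (Fin k) ℝ, (N.map Complex.ofReal).det = (N.det : ℂ) :=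
    fun N => (Complex.ofRealHom.map_det N).symm
  rw [hofReal] at hlim
  have hre := (Complex.continuous_re.tendsto _).comp hlim
  refine (hre.congr fun T => ?_).trans (le_of_eq ?_)
  · rw [scaledDet_eq, Function.comp]
    have := hofReal (Matrix.of fun i j => scaledEntry a p (m T) (√(T : ℝ)) (d T) (x T) i (z T j))
    exact (congrArg Complex.re this).trans (Complex.ofReal_re _)
  · congr 1
    have : (∏ j, (Real.exp (-(c / 2) * ζ j ^ 2) : ℂ)) * ((κ : ℂ) * (M.det : ℂ)) =
        ((κ * ((∏ j, Real.exp (-(c / 2) * ζ j ^ 2)) * M.det) : ℝ) : ℂ) := by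
      push_cast; ring
    rw [this, Complex.ofReal_re]
    rfl

/-- Exponential decay of the scaled determinants in every coordinate, uniformly in `T`. -/
theorem exists_scaledDet_le {k : ℕ} {p : ℝ} (hp : p ∈ Set.Ioo (0 : ℝ) 1) {m : ℕ → ℕ}
    (hmT : ∀ T, m T ≤ T) {τ : ℝ} (hτ : 0 < τ)
    (hm : Tendsto (fun T : ℕ => (m T : ℝ) / T) atTop (𝓝 τ)) {a : Fin k → ℝ} {d : ℕ → ℝ}
    {x : ℕ → Fin k → ℤ} (hx : ∀ T, StrictAnti (x T))
    (hxa : ∀ i, Tendsto (fun T : ℕ => (x T i - d T) / √(T : ℝ)) atTop (𝓝 (a i))) :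
    ∃ C ≥ 0, ∀ᶠ T : ℕ in atTop, ∀ z : Fin k → ℤ,
      |scaledDet a p (m T) (√(T : ℝ)) (d T) (x T) z| ≤
        C * ∏ j, Real.exp (-|(z j - d T - p * m T) / √(T : ℝ)|) := by
  set R := ∑ i, |a i| + 1 with hR
  have hR1 : 1 ≤ R := by
    have : 0 ≤ ∑ i, |a i| := Finset.sum_nonneg fun _ _ => abs_nonneg _
    linarith
  have haR : ∀ i, |a i| < R := fun i => by
    have := Finset.single_le_sum (f := fun i => |a i|) (fun _ _ => abs_nonneg _)
      (Finset.mem_univ i)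
    linarith
  choose C hC0 hC using fun i =>
    exists_norm_integral_le hp hmT hτ hm (card_blockUpTo a i) R hR1
  set C' := ∑ i, C i with hC'
  have hCC' : ∀ i, C i ≤ C' := fun i => Finset.single_le_sum (fun i _ => hC0 i) (Finset.mem_univ i)
  have hC'0 : 0 ≤ C' := Finset.sum_nonneg fun i _ => hC0 i
  refine ⟨k.factorial * C' ^ k, by positivity, ?_⟩
  have hxR : ∀ᶠ T : ℕ in atTop, ∀ i, |(x T i - d T) / √(T : ℝ)| ≤ R := by
    rw [eventually_all]
    intro i
    filter_upwards [(hxa i).abs.eventually (gt_mem_nhds (haR i))] with T hT using hT.le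
  filter_upwards [(eventually_all (l := atTop)).2 hC, hxR, eventually_ge_atTop 1] with T hT hTR hT1 z
  have hr : 0 < √(T : ℝ) := Real.sqrt_pos.2 (by exact_mod_cast hT1)
  set η : Fin k → ℝ := fun j => (z j - d T - p * m T) / √(T : ℝ) with hη
  have hentry : ∀ i j, |Real.exp |η j| *
      scaledEntry a p (m T) (√(T : ℝ)) (d T) (x T) i (z j)| ≤ C' := by
    intro i j
    have hinj : Set.InjOn (fun i => (x T i - d T) / √(T : ℝ)) (blockUpTo a i) := by
      intro l _ l' _ h
      have h1 : (x T l : ℝ) = x T l' := by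
        have := (div_left_inj' hr.ne').1 h
        linarith
      exact (hx T).injective (by exact_mod_cast h1)
    obtain ⟨U, hU⟩ := hT i _ hinj (fun l _ => hTR l) (η j)
    have h2 := scaledEntry_eq_integral a p (m T) hr (d T) (x T) i (z j) U
    have h3 : |scaledEntry a p (m T) (√(T : ℝ)) (d T) (x T) i (z j)| ≤
        C i * Real.exp (-|η j|) := by
      rw [← Real.norm_eq_abs, ← Complex.norm_real, h2, norm_mul]
      refine (mul_le_of_le_one_left (norm_nonneg _) ?_).trans hU
      rw [norm_inv]
      refine inv_le_one_of_one_le₀ ?_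
      rw [norm_mul, Complex.norm_real, Complex.norm_ofNat, Real.norm_eq_abs,
        abs_of_pos Real.pi_pos]
      linarith [Real.pi_gt_three]
    rw [abs_mul, abs_of_pos (Real.exp_pos _)]
    calc _ ≤ Real.exp |η j| * (C i * Real.exp (-|η j|)) := by gcongr
      _ = C i := by
        rw [mul_left_comm, ← Real.exp_add, add_neg_cancel, Real.exp_zero, mul_one]
      _ ≤ C' := hCC' i
  have hdet := Matrix.det_le (abv := AbsoluteValue.abs)
    (A := Matrix.of fun i j => Real.exp |η j| *
      scaledEntry a p (m T) (√(T : ℝ)) (d T) (x T) i (z j)) (x := C') hentry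
  have hfactor : scaledDet a p (m T) (√(T : ℝ)) (d T) (x T) z =
      (∏ j, Real.exp (-|η j|)) * (Matrix.of fun i j => Real.exp |η j| *
      scaledEntry a p (m T) (√(T : ℝ)) (d T) (x T) i (z j)).det := by
    rw [scaledDet_eq, ← Matrix.det_mul_row]
    congr 1
    ext i j
    simp only [Matrix.of_apply]
    rw [← mul_assoc, ← Real.exp_add, neg_add_cancel, Real.exp_zero, one_mul]
  rw [hfactor, abs_mul, abs_of_pos (Finset.prod_pos fun _ _ => Real.exp_pos _), mul_comm]
  refine mul_le_mul_of_nonneg_right ?_ (Finset.prod_nonneg fun _ _ => (Real.exp_pos _).le)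
  simpa using hdet

/-! ### Non-crossing collections weighted by scaled determinants -/

lemma intChoose_symm (n : ℕ) (l : ℤ) : intChoose n (n - l) = intChoose n l := by
  unfold intChoose
  by_cases h0 : 0 ≤ l
  · by_cases h1 : l ≤ n
    · rw [if_pos (by omega), if_pos h0]
      obtain ⟨j, rfl⟩ : ∃ j : ℕ, l = j := ⟨l.toNat, by omega⟩
      have : ((n : ℤ) - j).toNat = n - j := by omega
      rw [this, Int.toNat_natCast, Nat.choose_symm (by omega)]
    · rw [if_neg (by omega), if_pos h0, Nat.choose_eq_zero_of_lt (by omega)]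
      simp
  · rw [if_pos (by omega), if_neg h0, Nat.choose_eq_zero_of_lt (by omega)]
    simp

/-- Time reversal: paths from `z` to `y` become paths from `y - n` to `z`. -/
lemma chooseDet_reflect {k : ℕ} (n : ℕ) (z y : Fin k → ℤ) :
    chooseDet n (fun i => y i - n) z = chooseDet n z y := by
  rw [chooseDet, chooseDet, ← Matrix.det_transpose]
  congr 1
  ext i j
  simp only [Matrix.transpose_apply, Matrix.of_apply]
  rw [← intChoose_symm]
  congr 1
  ring

lemma det_binomWeight {k : ℕ} {p : ℝ} (hp0 : p ≠ 0) (hp1 : 1 - p ≠ 0) (m : ℕ) (r : ℝ)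
    (x z : Fin k → ℤ) :
    (Matrix.of fun l j => r * binomWeight p m (z j - x l)).det =
      (∏ l, r * (p ^ (-x l) * (1 - p) ^ ((m : ℤ) + x l))) *
        ((∏ j, p ^ (z j) * (1 - p) ^ (-z j)) * chooseDet m x z) := by
  rw [chooseDet, ← Matrix.det_mul_row, ← Matrix.det_mul_column]
  congr 1
  ext l j
  simp only [Matrix.of_apply, binomWeight]
  have h1 : p ^ (z j - x l) = p ^ (z j) * p ^ (-x l) := by
    rw [← zpow_add₀ hp0, sub_eq_add_neg]
  have h2 : (1 - p) ^ ((m : ℤ) - (z j - x l)) = (1 - p) ^ (-z j) * (1 - p) ^ ((m : ℤ) + x l) := by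
    rw [← zpow_add₀ hp1]; congr 1; ring
  rw [h1, h2]
  ring

/-- A weight that is proportional to the number of non-crossing collections that are at `z` at time
`m`, written with the determinants whose scaling limits are known. -/
noncomputable def latticeWeight {k : ℕ} (a b : Fin k → ℝ) (p : ℝ) (m T : ℕ) (x y z : Fin k → ℤ) :
    ℝ :=
  open Classical in
  if Antitone z then
    scaledDet a p m (√(T : ℝ)) 0 (strictShift x) (strictShift z) *
      scaledDet b (1 - p) (T - m) (√(T : ℝ)) (p * T - (T - m : ℕ))
        (fun i => strictShift y i - (T - m : ℕ)) (strictShift z)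
  else 0

lemma exists_latticeWeight_eq {k : ℕ} (a b : Fin k → ℝ) {p : ℝ} (hp : p ∈ Set.Ioo (0 : ℝ) 1)
    (m : ℕ) {T : ℕ} (hT : 1 ≤ T) {x y : Fin k → ℤ} (hx : Antitone x) (hy : Antitone y) :
    ∃ C : ℝ, C ≠ 0 ∧ ∀ z, latticeWeight a b p m T x y z =
      C * ((avoidingFinset m x z).card * (avoidingFinset (T - m) z y).card) := by
  have hp0 : p ≠ 0 := hp.1.ne'
  have hp1 : 1 - p ≠ 0 := (sub_pos.2 hp.2).ne'
  have hr : √(T : ℝ) ≠ 0 := (Real.sqrt_pos.2 (by exact_mod_cast hT)).ne'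
  have hinj : ∀ (w : Fin k → ℤ) (d : ℝ), StrictAnti w →
      Function.Injective fun i => ((w i : ℝ) - d) / √(T : ℝ) := by
    intro w d hw i j h
    have h1 := (div_left_inj' hr).1 h
    exact hw.injective (by exact_mod_cast sub_left_injective h1)
  have hx' := strictAnti_strictShift hx
  have hy' : StrictAnti fun i => strictShift y i - (T - m : ℕ) := fun i j hij =>
    sub_lt_sub_right (strictAnti_strictShift hy hij) _
  refine ⟨((divDiffMatrix a fun i => (strictShift x i - (0 : ℝ)) / √(T : ℝ)).det *
      ∏ l, √(T : ℝ) * (p ^ (-strictShift x l) * (1 - p) ^ ((m : ℤ) + strictShift x l))) *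
    ((divDiffMatrix b fun i => (((strictShift y i - (T - m : ℕ) : ℤ) : ℝ) -
        (p * T - (T - m : ℕ))) / √(T : ℝ)).det *
      ∏ l, √(T : ℝ) * ((1 - p) ^ (-(strictShift y l - (T - m : ℕ))) *
        (1 - (1 - p)) ^ (((T - m : ℕ) : ℤ) + (strictShift y l - (T - m : ℕ))))), ?_, fun z => ?_⟩
  · have hp2 : 1 - (1 - p) ≠ 0 := by rwa [sub_sub_cancel]
    refine mul_ne_zero (mul_ne_zero (det_divDiffMatrix_ne_zero a (hinj _ 0 hx')) ?_)
      (mul_ne_zero (det_divDiffMatrix_ne_zero b (hinj _ _ hy')) ?_)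
    · exact Finset.prod_ne_zero_iff.2 fun l _ =>
        mul_ne_zero hr (mul_ne_zero (zpow_ne_zero _ hp0) (zpow_ne_zero _ hp1))
    · exact Finset.prod_ne_zero_iff.2 fun l _ =>
        mul_ne_zero hr (mul_ne_zero (zpow_ne_zero _ hp1) (zpow_ne_zero _ hp2))
  · unfold latticeWeight
    split_ifs with hz
    · rw [card_avoidingFinset m hx hz, card_avoidingFinset (T - m) hz hy,
        ← chooseDet_reflect (T - m) (strictShift z) (strictShift y), scaledDet, scaledDet,
        det_binomWeight hp0 hp1, det_binomWeight hp1 (by rwa [sub_sub_cancel])]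
      -- the powers of `p` and `1 - p` that depend on `z` cancel
      have hcancel : (∏ j, p ^ (strictShift z j) * (1 - p) ^ (-strictShift z j)) *
          (∏ j, (1 - p) ^ (strictShift z j) * (1 - (1 - p)) ^ (-strictShift z j)) = 1 := by
        rw [← Finset.prod_mul_distrib]
        refine Finset.prod_eq_one fun j _ => ?_
        rw [sub_sub_cancel, zpow_neg, zpow_neg]
        field_simp
      linear_combination (((divDiffMatrix a fun i => (strictShift x i - (0 : ℝ)) / √(T : ℝ)).det *
        ∏ l, √(T : ℝ) * (p ^ (-strictShift x l) * (1 - p) ^ ((m : ℤ) + strictShift x l))) *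
      ((divDiffMatrix b fun i => (((strictShift y i - (T - m : ℕ) : ℤ) : ℝ) -
          (p * T - (T - m : ℕ))) / √(T : ℝ)).det *
        ∏ l, √(T : ℝ) * ((1 - p) ^ (-(strictShift y l - (T - m : ℕ))) *
          (1 - (1 - p)) ^ (((T - m : ℕ) : ℤ) + (strictShift y l - (T - m : ℕ)))))) *
        (chooseDet m (strictShift x) (strictShift z) *
          chooseDet (T - m) (fun i => strictShift y i - (T - m : ℕ)) (strictShift z)) * hcancel
    · rw [avoidingFinset_eq_empty_of_not_antitone hz]
      simp

/-! ### Sums over lattice points as integrals of step functions -/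

/-- The lattice point whose cell, after scaling by `r` and translation by `e`, contains `ζ`. -/
noncomputable def latticePoint {k : ℕ} (r e : ℝ) (ζ : Fin k → ℝ) : Fin k → ℤ :=
  fun i => ⌊r * ζ i + e⌋

lemma measurable_latticePoint {k : ℕ} (r e : ℝ) :
    Measurable (latticePoint r e : (Fin k → ℝ) → Fin k → ℤ) := by
  unfold latticePoint
  fun_prop

lemma integral_comp_latticePoint {k : ℕ} {r : ℝ} (hr : 0 < r) (e : ℝ) (G : (Fin k → ℤ) → ℝ)
    (Z : Finset (Fin k → ℤ)) (hG : ∀ z ∉ Z, G z = 0) :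
    ∫ ζ : Fin k → ℝ, G (latticePoint r e ζ) = (r⁻¹) ^ k * ∑ z ∈ Z, G z := by
  classical
  set cell : (Fin k → ℤ) → Set (Fin k → ℝ) := fun z =>
    Set.univ.pi fun i => Set.Ico ((z i - e) / r) ((z i + 1 - e) / r) with hcell
  have hmem : ∀ z ζ, ζ ∈ cell z ↔ latticePoint r e ζ = z := by
    intro z ζ
    simp only [hcell, Set.mem_pi, Set.mem_univ, true_implies, Set.mem_Ico, latticePoint,
      funext_iff, Int.floor_eq_iff, div_le_iff₀ hr, lt_div_iff₀ hr]
    refine forall_congr' fun i => ⟨fun h => ⟨?_, ?_⟩, fun h => ⟨?_, ?_⟩⟩ <;>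
      linarith [h.1, h.2]
  have hmeas : ∀ z, MeasurableSet (cell z) := fun z =>
    MeasurableSet.univ_pi fun i => measurableSet_Ico
  have hvol : ∀ z, volume.real (cell z) = (r⁻¹) ^ k := by
    intro z
    rw [Measure.real, hcell, Real.volume_pi_Ico_toReal]
    · have : ∀ i, ((z i : ℝ) + 1 - e) / r - (z i - e) / r = r⁻¹ := fun i => by
        field_simp; ring
      simp only [this, Finset.prod_const, Finset.card_univ, Fintype.card_fin]
    · intro i
      show ((z i : ℝ) - e) / r ≤ (z i + 1 - e) / r
      gcongr
      linarith
  have hfin : ∀ z, volume (cell z) ≠ ⊤ := by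
    intro z
    rw [hcell, Real.volume_pi_Ico]
    exact ENNReal.prod_ne_top fun _ _ => ENNReal.ofReal_ne_top
  have hsum : ∀ ζ, G (latticePoint r e ζ) = ∑ z ∈ Z, (cell z).indicator (fun _ => G z) ζ := by
    intro ζ
    simp only [Set.indicator_apply, hmem, Finset.sum_ite_eq]
    split_ifs with h
    · rfl
    · exact hG _ h
  simp only [hsum]
  rw [integral_finsetSum _ fun z _ => (integrable_indicator_iff (hmeas z)).2
    (integrableOn_const (hfin z)), Finset.mul_sum]
  refine Finset.sum_congr rfl fun z _ => ?_
  rw [integral_indicator_const _ (hmeas z), hvol, smul_eq_mul]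

/-- Expectations with respect to the non-crossing law of functions of the positions at time
`m`. -/
lemma integral_avoidingLaw {k T : ℕ} {x y : Fin k → ℤ}
    (F : (Fin k → Fin (T + 1) → ℤ) → ℝ) :
    ∫ L, F L ∂(avoidingLaw T x y) =
      (∑ B ∈ avoidingFinset T x y, F B) / (avoidingFinset T x y).card := by
  have hset : avoidingPaths T x y = avoidingFinset T x y := by simp [avoidingFinset]
  have hint : IntegrableOn F (avoidingFinset T x y) Measure.count := by
    have h : (avoidingFinset T x y : Set (Fin k → Fin (T + 1) → ℤ)) =
        ⋃ B ∈ avoidingFinset T x y, {B} :=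
      (Set.biUnion_of_singleton _).symm
    rw [h, integrableOn_finset_iUnion]
    exact fun B _ => integrableOn_singleton
      (hx := by rw [Measure.count_singleton]; exact ENNReal.one_lt_top)
  rw [avoidingLaw_eq_uniformOn, hset, uniformOn, ProbabilityTheory.cond, integral_smul_measure,
    setIntegral_finset _ hint]
  simp [Measure.real, div_eq_inv_mul]

/-- The expectation of a function of the position at time `m` is a quotient of integrals of step
functions. -/
theorem integral_position_eq {k : ℕ} (a b : Fin k → ℝ) {p : ℝ} (hp : p ∈ Set.Ioo (0 : ℝ) 1)
    {m T : ℕ} (hmT : m ≤ T) (hT : 1 ≤ T) {x y : Fin k → ℤ} (hx : Antitone x) (hy : Antitone y)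
    (e : ℝ) (F : (Fin k → ℤ) → ℝ) :
    ((∫ ζ, latticeWeight a b p m T x y (latticePoint (√(T : ℝ)) e ζ)) ≠ 0 →
      (avoidingFinset T x y).Nonempty) ∧
    ∫ L, F (fun i => L i ⟨m, by omega⟩) ∂(avoidingLaw T x y) =
      (∫ ζ, latticeWeight a b p m T x y (latticePoint (√(T : ℝ)) e ζ) *
        F (latticePoint (√(T : ℝ)) e ζ)) /
      ∫ ζ, latticeWeight a b p m T x y (latticePoint (√(T : ℝ)) e ζ) := by
  have hr : 0 < √(T : ℝ) := Real.sqrt_pos.2 (by exact_mod_cast hT)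
  obtain ⟨C, hC, hw⟩ := exists_latticeWeight_eq a b hp m hT hx hy
  set Z : Finset (Fin k → ℤ) := Fintype.piFinset fun i => Finset.Icc (x i) (x i + m) with hZ
  have hmemZ : ∀ z : Fin k → ℤ, z ∈ Z ↔ ∀ i, x i ≤ z i ∧ z i ≤ x i + m := fun z => by
    simp [hZ, Fintype.mem_piFinset]
  have key : ∀ F : (Fin k → ℤ) → ℝ,
      ∫ ζ, latticeWeight a b p m T x y (latticePoint (√(T : ℝ)) e ζ) *
        F (latticePoint (√(T : ℝ)) e ζ) =
      ((√(T : ℝ))⁻¹ ^ k * C) * ∑ B ∈ avoidingFinset T x y, F (fun i => B i ⟨m, by omega⟩) := by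
    intro F
    rw [integral_comp_latticePoint hr e (fun z => latticeWeight a b p m T x y z * F z) Z,
      sum_avoidingFinset_eval m (T - m) T (by omega) F Z fun z hz => (hmemZ z).2 hz, mul_assoc,
      Finset.mul_sum _ _ C]
    · congr 1
      refine Finset.sum_congr rfl fun z _ => ?_
      rw [hw]; ring
    · intro z hz
      rw [hw, avoidingFinset_eq_empty fun h => hz ((hmemZ z).2 h)]
      simp
  have hone := key fun _ => 1
  simp only [mul_one, Finset.sum_const, nsmul_eq_mul] at hone
  constructor
  · intro h
    rw [Finset.nonempty_iff_ne_empty]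
    intro h0
    rw [hone, h0] at h
    simp at h
  · rw [integral_avoidingLaw, key F, hone, mul_div_mul_left]
    exact mul_ne_zero (pow_ne_zero _ (inv_ne_zero hr.ne')) hC

/-! ### The limiting density -/

lemma isOpen_openWeylChamber (k : ℕ) : IsOpen (openWeylChamber k) := by
  have : openWeylChamber k = ⋂ i : Fin k, ⋂ j : Fin k, {z | i < j → z j < z i} := by
    ext z
    simp only [openWeylChamber, StrictAnti, Set.mem_ofPred_eq, Set.mem_iInter]
  rw [this]
  refine isOpen_iInter_of_finite fun i => isOpen_iInter_of_finite fun j => ?_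
  by_cases hij : i < j
  · simp only [hij, true_implies]
    exact isOpen_lt (continuous_apply j) (continuous_apply i)
  · simp [hij]

lemma isClosed_weylChamber (k : ℕ) : IsClosed (weylChamber k) := by
  have : weylChamber k = ⋂ i : Fin k, ⋂ j : Fin k, {z | i ≤ j → z j ≤ z i} := by
    ext z
    simp only [weylChamber, Antitone, Set.mem_ofPred_eq, Set.mem_iInter]
  rw [this]
  refine isClosed_iInter fun i => isClosed_iInter fun j => ?_
  by_cases hij : i ≤ j
  · simp only [hij, true_implies]
    exact isClosed_le (continuous_apply j) (continuous_apply i)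
  · simp [hij]

lemma convex_openWeylChamber (k : ℕ) : Convex ℝ (openWeylChamber k) := by
  intro u hu v hv s t hs ht hst i j hij
  have h1 := hu hij
  have h2 := hv hij
  simp only [Pi.add_apply, Pi.smul_apply, smul_eq_mul]
  rcases hs.eq_or_lt with rfl | hs
  · have : t = 1 := by linarith
    subst this; linarith
  · nlinarith

lemma openWeylChamber_nonempty (k : ℕ) : (openWeylChamber k).Nonempty :=
  ⟨fun i => -(i : ℝ), fun i j hij => by
    have : ((i : ℕ) : ℝ) < (j : ℕ) := by exact_mod_cast hij
    simpa using this⟩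

lemma openWeylChamber_subset (k : ℕ) : openWeylChamber k ⊆ weylChamber k :=
  fun _ hz => StrictAnti.antitone hz

lemma continuous_unnormalizedDensity {k : ℕ} (p t : ℝ) (a b : Fin k → ℝ) :
    Continuous (unnormalizedDensity p t a b) := by
  unfold unnormalizedDensity
  have h1 := continuous_confluentDet (c₁ p t) a
  have h2 := continuous_confluentDet (c₂ p t) b
  fun_prop

lemma indicator_openWeylChamber_eq {k : ℕ} (p t : ℝ) (a b : Fin k → ℝ) :
    (openWeylChamber k).indicator (unnormalizedDensity p t a b) =
      (weylChamber k).indicator (unnormalizedDensity p t a b) := by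
  funext z
  by_cases hz : z ∈ openWeylChamber k
  · rw [Set.indicator_of_mem hz, Set.indicator_of_mem (openWeylChamber_subset k hz)]
  · rw [Set.indicator_of_notMem hz]
    by_cases hz' : z ∈ weylChamber k
    · have hinj : ¬ Function.Injective z := fun h =>
        hz (Antitone.strictAnti_of_injective hz' h)
      rw [Set.indicator_of_mem hz', unnormalizedDensity, confluentDet_eq_zero _ _ hinj]
      ring
    · rw [Set.indicator_of_notMem hz']

/-- By connectedness of the open chamber and the absence of zeros, the unnormalized density has a
constant sign `ε` there. -/
lemma exists_sign_unnormalizedDensity {k : ℕ} {p t : ℝ} (hp : p ∈ Set.Ioo (0 : ℝ) 1)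
    (ht : t ∈ Set.Ioo (0 : ℝ) 1) (a b : Fin k → ℝ) :
    ∃ ε : ℝ, ∀ z ∈ openWeylChamber k, 0 < ε * unnormalizedDensity p t a b z := by
  have hq : 0 < 1 - p := sub_pos.2 hp.2
  have hs : 0 < 1 - t := sub_pos.2 ht.2
  have hc1 : c₁ p t ≠ 0 := by
    unfold c₁; exact (one_div_pos.2 (mul_pos (mul_pos hp.1 hq) ht.1)).ne'
  have hc2 : c₂ p t ≠ 0 := by
    unfold c₂; exact (one_div_pos.2 (mul_pos (mul_pos hp.1 hq) hs)).ne'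
  have hne : ∀ z ∈ openWeylChamber k, unnormalizedDensity p t a b z ≠ 0 := by
    intro z hz
    have hinj : Function.Injective z := StrictAnti.injective hz
    exact mul_ne_zero (mul_ne_zero (confluentDet_ne_zero hc1 a hinj)
      (confluentDet_ne_zero hc2 b hinj)) (Finset.prod_pos fun _ _ => Real.exp_pos _).ne'
  obtain ⟨w, hw⟩ := openWeylChamber_nonempty k
  refine ⟨unnormalizedDensity p t a b w, fun z hz => ?_⟩
  by_contra hneg
  have hlt := lt_of_le_of_ne (not_lt.1 hneg) (mul_ne_zero (hne w hw) (hne z hz))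
  have hpos := mul_self_pos.2 (hne w hw)
  obtain ⟨u, hu, hu0⟩ := (convex_openWeylChamber k).isPreconnected.intermediate_value hz hw
    ((continuous_unnormalizedDensity p t a b).const_mul
      (unnormalizedDensity p t a b w)).continuousOn ⟨hlt.le, hpos.le⟩
  exact mul_ne_zero (hne w hw) (hne u hu) hu0

/-- All the assertions on the density, given that the unnormalized density is integrable. -/
lemma density_properties {k : ℕ} {p t : ℝ} (hp : p ∈ Set.Ioo (0 : ℝ) 1)
    (ht : t ∈ Set.Ioo (0 : ℝ) 1) (a b : Fin k → ℝ)
    (hint : IntegrableOn (unnormalizedDensity p t a b) (weylChamber k)) :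
    normalization p t a b ≠ 0 ∧ (∀ z, 0 ≤ density p t a b z) ∧ (∫ z, density p t a b z) = 1 ∧
      Function.support (density p t a b) = openWeylChamber k := by
  obtain ⟨ε, hε⟩ := exists_sign_unnormalizedDensity hp ht a b
  have hmeas := (isClosed_weylChamber k).measurableSet
  have hnonneg : ∀ z ∈ weylChamber k, 0 ≤ ε * unnormalizedDensity p t a b z := by
    intro z hz
    by_cases hz' : z ∈ openWeylChamber k
    · exact (hε z hz').le
    · have := congrFun (indicator_openWeylChamber_eq p t a b) z
      rw [Set.indicator_of_notMem hz', Set.indicator_of_mem hz] at this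
      rw [← this, mul_zero]
  have hpos : 0 < ε * normalization p t a b := by
    rw [normalization, ← integral_const_mul, setIntegral_pos_iff_support_of_nonneg_ae
      ((ae_restrict_iff' hmeas).2 (ae_of_all _ hnonneg)) (hint.const_mul ε)]
    refine ((isOpen_openWeylChamber k).measure_pos volume (openWeylChamber_nonempty k)).trans_le
      (measure_mono fun z hz => ⟨(hε z hz).ne', openWeylChamber_subset k hz⟩)
  have hε0 : ε ≠ 0 := fun h => by simp [h] at hpos
  have hZ : normalization p t a b ≠ 0 := fun h => by simp [h] at hpos
  have hdens : ∀ z, density p t a b z = (ε * normalization p t a b)⁻¹ *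
      (openWeylChamber k).indicator (fun z => ε * unnormalizedDensity p t a b z) z := by
    intro z
    rw [density, mul_inv]
    by_cases hz : z ∈ openWeylChamber k
    · rw [Set.indicator_of_mem hz, Set.indicator_of_mem hz]
      field_simp
    · rw [Set.indicator_of_notMem hz, Set.indicator_of_notMem hz]
      ring
  refine ⟨hZ, fun z => ?_, ?_, ?_⟩
  · rw [hdens]
    exact mul_nonneg (inv_nonneg.2 hpos.le) (Set.indicator_nonneg (fun z hz => (hε z hz).le) z)
  · simp only [density]
    rw [integral_const_mul, indicator_openWeylChamber_eq, integral_indicator hmeas]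
    exact inv_mul_cancel₀ hZ
  · ext z
    rw [Function.mem_support, hdens]
    by_cases hz : z ∈ openWeylChamber k
    · rw [Set.indicator_of_mem hz]
      exact iff_of_true (mul_ne_zero (inv_ne_zero hpos.ne') (hε z hz).ne') hz
    · rw [Set.indicator_of_notMem hz]
      simp [hz]

lemma integrable_exp_neg_abs : Integrable fun x : ℝ => Real.exp (-|x|) := by
  refine (integrable_inv_one_add_sq.const_mul 2).mono' (by fun_prop) (ae_of_all _ fun x => ?_)
  have h1 := Real.quadratic_le_exp_of_nonneg (abs_nonneg x)
  have h2 : 0 ≤ |x| := abs_nonneg x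
  have h3 : 0 < 1 + x ^ 2 := by positivity
  rw [sq_abs] at h1
  rw [Real.norm_of_nonneg (Real.exp_pos _).le, Real.exp_neg, ← div_eq_mul_inv,
    inv_le_comm₀ (Real.exp_pos _) (by positivity), inv_div]
  linarith

lemma integrable_prod_exp_neg_abs (k : ℕ) :
    Integrable fun ζ : Fin k → ℝ => ∏ j, Real.exp (-|ζ j|) :=
  Integrable.fintype_prod fun _ => integrable_exp_neg_abs

/-! ### Convergence of the positions at the last integer time before `t T` -/

/-- The integer time `⌊t T⌋`. The minimum with `T` is only there to make the bound by `T`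
immediate. -/
noncomputable def obsTime (t : ℝ) (T : ℕ) : ℕ := min ⌊t * T⌋₊ T

lemma obsTime_le (t : ℝ) (T : ℕ) : obsTime t T ≤ T := min_le_right _ _

lemma obsTime_eq {t : ℝ} (ht : t ∈ Set.Ioo (0 : ℝ) 1) (T : ℕ) : obsTime t T = ⌊t * T⌋₊ := by
  refine min_eq_left (Nat.floor_le_of_le ?_)
  nlinarith [ht.2, (Nat.cast_nonneg T : (0 : ℝ) ≤ T)]

lemma obsTime_bounds {t : ℝ} (ht : t ∈ Set.Ioo (0 : ℝ) 1) (T : ℕ) :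
    0 ≤ t * T - obsTime t T ∧ t * T - obsTime t T ≤ 1 := by
  have h0 : 0 ≤ t * T := mul_nonneg ht.1.le (Nat.cast_nonneg T)
  rw [obsTime_eq ht]
  have h1 := Nat.floor_le h0
  have h2 := Nat.lt_floor_add_one (t * T)
  constructor <;> linarith

lemma tendsto_obsTime {t : ℝ} (ht : t ∈ Set.Ioo (0 : ℝ) 1) :
    Tendsto (fun T : ℕ => (obsTime t T : ℝ) / T) atTop (𝓝 t) := by
  refine ((tendsto_nat_floor_mul_div_atTop ht.1.le).comp tendsto_natCast_atTop_atTop).congr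
    fun T => ?_
  simp [obsTime_eq ht]

lemma tendsto_sub_obsTime {t : ℝ} (ht : t ∈ Set.Ioo (0 : ℝ) 1) :
    Tendsto (fun T : ℕ => ((T - obsTime t T : ℕ) : ℝ) / T) atTop (𝓝 (1 - t)) := by
  refine ((tendsto_obsTime ht).const_sub 1).congr' ?_
  filter_upwards [eventually_ge_atTop 1] with T hT
  have : (T : ℝ) ≠ 0 := by exact_mod_cast (by omega : T ≠ 0)
  rw [Nat.cast_sub (obsTime_le t T)]
  field_simp

lemma tendsto_const_div_sqrt (c : ℝ) : Tendsto (fun T : ℕ => c / √(T : ℝ)) atTop (𝓝 0) :=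
  tendsto_const_nhds.div_atTop (Real.tendsto_sqrt_atTop.comp tendsto_natCast_atTop_atTop)

/-- The rescaled positions at the integer time `⌊t T⌋`. -/
noncomputable def rescaledAtObsTime {k T : ℕ} (p t : ℝ) (L : Fin k → Fin (T + 1) → ℤ) :
    Fin k → ℝ :=
  fun i => ((L i ⟨obsTime t T, Nat.lt_succ_of_le (obsTime_le t T)⟩ : ℝ) - p * t * T) / √(T : ℝ)

/-- Scaling limit of the weights, up to an unknown constant `κ`, with an integrable bound. The
positions are centred at `p t T` and the determinants at `p ⌊t T⌋`, a difference that vanishes in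
the limit. -/
theorem tendsto_latticeWeight {k : ℕ} {p t : ℝ} (hp : p ∈ Set.Ioo (0 : ℝ) 1)
    (ht : t ∈ Set.Ioo (0 : ℝ) 1) {a b : Fin k → ℝ} {x y : ℕ → Fin k → ℤ}
    (hx : ∀ T, Antitone (x T)) (hy : ∀ T, Antitone (y T))
    (hxa : ∀ i, Tendsto (fun T : ℕ => (x T i : ℝ) / √(T : ℝ)) atTop (𝓝 (a i)))
    (hyb : ∀ i, Tendsto (fun T : ℕ => ((y T i : ℝ) - p * T) / √(T : ℝ)) atTop (𝓝 (b i))) :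
    ∃ κ : ℝ, κ ≠ 0 ∧ Integrable (unnormalizedDensity p t a b) ∧ ∃ D : ℝ,
      (∀ ζ, Tendsto (fun T : ℕ => latticeWeight a b p (obsTime t T) T (x T) (y T)
        (latticePoint (√(T : ℝ)) (p * t * T) ζ)) atTop
          (𝓝 (κ * (weylChamber k).indicator (unnormalizedDensity p t a b) ζ))) ∧
      ∀ᶠ T : ℕ in atTop, ∀ ζ, |latticeWeight a b p (obsTime t T) T (x T) (y T)
        (latticePoint (√(T : ℝ)) (p * t * T) ζ)| ≤ D * ∏ j, Real.exp (-|ζ j|) := by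
  have hp' : 1 - p ∈ Set.Ioo (0 : ℝ) 1 := ⟨by linarith [hp.2], by linarith [hp.1]⟩
  have hxs : ∀ T, StrictAnti (strictShift (x T)) := fun T => strictAnti_strictShift (hx T)
  have hys : ∀ T, StrictAnti fun i => strictShift (y T) i - (T - obsTime t T : ℕ) :=
    fun T i j hij => sub_lt_sub_right (strictAnti_strictShift (hy T) hij) _
  have hxa' : ∀ i, Tendsto (fun T : ℕ => ((strictShift (x T) i : ℝ) - 0) / √(T : ℝ)) atTop
      (𝓝 (a i)) := by
    intro i
    have h := (hxa i).sub (tendsto_const_div_sqrt (i : ℕ))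
    rw [sub_zero] at h
    refine h.congr fun T => ?_
    simp only [strictShift]
    push_cast
    ring
  have hyb' : ∀ i, Tendsto (fun T : ℕ => (((strictShift (y T) i - (T - obsTime t T : ℕ) : ℤ) : ℝ) -
      (p * T - (T - obsTime t T : ℕ))) / √(T : ℝ)) atTop (𝓝 (b i)) := by
    intro i
    have h := (hyb i).sub (tendsto_const_div_sqrt (i : ℕ))
    rw [sub_zero] at h
    refine h.congr fun T => ?_
    simp only [strictShift]
    push_cast
    ring
  have hmT : ∀ T, obsTime t T ≤ T := obsTime_le t
  have hnT : ∀ T, T - obsTime t T ≤ T := fun T => Nat.sub_le _ _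
  have ht' : 0 < 1 - t := by linarith [ht.2]
  obtain ⟨κ₁, hκ₁, hlim₁⟩ :=
    exists_tendsto_scaledDet hp hmT ht.1 (tendsto_obsTime ht) hxs hxa'
  obtain ⟨κ₂, hκ₂, hlim₂⟩ :=
    exists_tendsto_scaledDet hp' hnT ht' (tendsto_sub_obsTime ht) hys hyb'
  obtain ⟨C₁, hC₁, hbd₁⟩ := exists_scaledDet_le hp hmT ht.1 (tendsto_obsTime ht) hxs hxa'
  obtain ⟨C₂, hC₂, hbd₂⟩ := exists_scaledDet_le hp' hnT ht' (tendsto_sub_obsTime ht) hys hyb'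
  set z : (Fin k → ℝ) → ℕ → Fin k → ℤ := fun ζ T =>
    strictShift (latticePoint (√(T : ℝ)) (p * t * T) ζ) with hz
  set A : (Fin k → ℝ) → ℕ → ℝ := fun ζ T =>
    scaledDet a p (obsTime t T) (√(T : ℝ)) 0 (strictShift (x T)) (z ζ T) with hA
  set B : (Fin k → ℝ) → ℕ → ℝ := fun ζ T =>
    scaledDet b (1 - p) (T - obsTime t T) (√(T : ℝ)) (p * T - (T - obsTime t T : ℕ))
        (fun i => strictShift (y T) i - (T - obsTime t T : ℕ)) (z ζ T) with hB
  -- both determinants see the same rescaled positions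
  have hsame : ∀ ζ T j, ((z ζ T j : ℝ) - (p * T - (T - obsTime t T : ℕ)) -
      (1 - p) * (T - obsTime t T : ℕ)) / √(T : ℝ) = (z ζ T j - 0 - p * obsTime t T) / √(T : ℝ) := by
    intro ζ T j
    rw [Nat.cast_sub (hmT T)]
    congr 1
    ring
  have hclose : ∀ᶠ T : ℕ in atTop, ∀ ζ j,
      |(z ζ T j - 0 - p * obsTime t T) / √(T : ℝ) - ζ j| ≤ (k + 2) / √(T : ℝ) := by
    filter_upwards [eventually_ge_atTop 1] with T hT ζ j
    have hr : 0 < √(T : ℝ) := Real.sqrt_pos.2 (by exact_mod_cast hT)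
    have h1 : (z ζ T j - 0 - p * obsTime t T) / √(T : ℝ) - ζ j =
        (z ζ T j - 0 - p * obsTime t T - √(T : ℝ) * ζ j) / √(T : ℝ) := by field_simp
    rw [h1, abs_div, abs_of_pos hr]
    gcongr
    obtain ⟨h2, h3⟩ := obsTime_bounds ht T
    have h4 := Int.floor_le (√(T : ℝ) * ζ j + p * t * T)
    have h5 := Int.lt_floor_add_one (√(T : ℝ) * ζ j + p * t * T)
    have h6 : ((j : ℕ) : ℝ) ≤ k := by exact_mod_cast j.2.le
    have h7 : (0 : ℝ) ≤ ((j : ℕ) : ℝ) := Nat.cast_nonneg _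
    have h8 : 0 ≤ p * (t * T - obsTime t T) := mul_nonneg hp.1.le h2
    have h9 : p * (t * T - obsTime t T) ≤ 1 := mul_le_one₀ hp.2.le h2 h3
    simp only [hz, strictShift, latticePoint]
    push_cast
    rw [abs_le]
    constructor <;> linarith
  have hzlim : ∀ ζ j, Tendsto (fun T : ℕ => (z ζ T j - 0 - p * obsTime t T) / √(T : ℝ)) atTop
      (𝓝 (ζ j)) := by
    intro ζ j
    rw [tendsto_iff_dist_tendsto_zero]
    refine squeeze_zero' (Eventually.of_forall fun _ => dist_nonneg) ?_
      (tendsto_const_div_sqrt (k + 2))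
    filter_upwards [hclose] with T hT using hT ζ j
  have hAB : ∀ ζ, Tendsto (fun T => A ζ T * B ζ T) atTop
      (𝓝 (κ₁ * κ₂ * unnormalizedDensity p t a b ζ)) := by
    intro ζ
    have h1 := hlim₁ (z ζ) ζ (hzlim ζ)
    have h2 := hlim₂ (z ζ) ζ fun j => (hzlim ζ j).congr fun T => (hsame ζ T j).symm
    refine (h1.mul h2).trans (le_of_eq ?_)
    congr 1
    have hc₂ : 1 / ((1 - p) * (1 - (1 - p)) * (1 - t)) = c₂ p t := by
      rw [c₂]; congr 1; ring
    have hc₁ : 1 / (p * (1 - p) * t) = c₁ p t := rfl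
    have hp0 := hp.1.ne'
    have hq0 := hp'.1.ne'
    have ht0 := ht.1.ne'
    have hexp : (∏ j, Real.exp (-(c₁ p t / 2) * ζ j ^ 2)) *
        (∏ j, Real.exp (-(c₂ p t / 2) * ζ j ^ 2)) = ∏ j, Real.exp (-(c₃ p t) * ζ j ^ 2) := by
      rw [← Finset.prod_mul_distrib]
      refine Finset.prod_congr rfl fun j _ => ?_
      rw [← Real.exp_add]
      congr 1
      have : c₃ p t = c₁ p t / 2 + c₂ p t / 2 := by
        rw [c₁, c₂, c₃]
        field_simp
        ring
      rw [this]
      ring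
    rw [hc₂, hc₁, unnormalizedDensity, ← hexp]
    ring
  have hABle : ∀ᶠ T : ℕ in atTop, ∀ ζ, |A ζ T * B ζ T| ≤
      (C₁ * C₂ * Real.exp (k + 2) ^ k) * ∏ j, Real.exp (-|ζ j|) := by
    filter_upwards [hbd₁, hbd₂, hclose, eventually_ge_atTop 1] with T h1 h2 h3 hT ζ
    have hr : 1 ≤ √(T : ℝ) := Real.one_le_sqrt.2 (by exact_mod_cast hT)
    have h4 : |B ζ T| ≤ C₂ := by
      refine (h2 (z ζ T)).trans (mul_le_of_le_one_right hC₂ ?_)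
      exact Finset.prod_le_one (fun _ _ => (Real.exp_pos _).le) fun j _ =>
        Real.exp_le_one_iff.2 (neg_nonpos.2 (abs_nonneg _))
    have h5 : |A ζ T| ≤ C₁ * (Real.exp (k + 2) ^ k * ∏ j, Real.exp (-|ζ j|)) := by
      refine (h1 (z ζ T)).trans (mul_le_mul_of_nonneg_left ?_ hC₁)
      have h6 : Real.exp (k + 2) ^ k = ∏ _j : Fin k, Real.exp (k + 2) := by simp
      rw [h6, ← Finset.prod_mul_distrib]
      refine Finset.prod_le_prod (fun _ _ => (Real.exp_pos _).le) fun j _ => ?_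
      rw [← Real.exp_add]
      refine Real.exp_le_exp.2 ?_
      have h7 : ((k : ℝ) + 2) / √(T : ℝ) ≤ k + 2 := div_le_self (by positivity) hr
      have h8 := abs_sub_abs_le_abs_sub (ζ j) ((z ζ T j - 0 - p * obsTime t T) / √(T : ℝ))
      have h9 := h3 ζ j
      rw [abs_sub_comm] at h9
      linarith
    rw [abs_mul]
    calc _ ≤ C₁ * (Real.exp (k + 2) ^ k * ∏ j, Real.exp (-|ζ j|)) * C₂ := by
          gcongr
      _ = _ := by ring
  have hκ : κ₁ * κ₂ ≠ 0 := mul_ne_zero hκ₁ hκ₂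
  have hlw : ∀ ζ T, latticeWeight a b p (obsTime t T) T (x T) (y T)
      (latticePoint (√(T : ℝ)) (p * t * T) ζ) =
        open Classical in if Antitone (latticePoint (√(T : ℝ)) (p * t * T) ζ) then A ζ T * B ζ T
          else 0 := fun ζ T => rfl
  refine ⟨κ₁ * κ₂, hκ, ?_, C₁ * C₂ * Real.exp (k + 2) ^ k, fun ζ => ?_, ?_⟩
  · have h : Integrable fun ζ => κ₁ * κ₂ * unnormalizedDensity p t a b ζ := by
      refine ((integrable_prod_exp_neg_abs k).const_mul
        (C₁ * C₂ * Real.exp (k + 2) ^ k)).mono'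
        ((continuous_unnormalizedDensity p t a b).const_mul _).aestronglyMeasurable
        (ae_of_all _ fun ζ => ?_)
      exact le_of_tendsto (hAB ζ).norm (hABle.mono fun T hT => hT ζ)
    exact (h.const_mul (κ₁ * κ₂)⁻¹).congr (ae_of_all _ fun ζ => inv_mul_cancel_left₀ hκ _)
  · by_cases hζ : ζ ∈ weylChamber k
    · rw [Set.indicator_of_mem hζ]
      refine (hAB ζ).congr fun T => ?_
      rw [hlw, if_pos]
      intro i j hij
      exact Int.floor_le_floor (by gcongr; exact hζ hij)
    · rw [Set.indicator_of_notMem hζ, mul_zero]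
      refine tendsto_const_nhds.congr' ?_
      simp only [weylChamber, Antitone, Set.mem_ofPred_eq] at hζ
      push Not at hζ
      obtain ⟨i, j, hij, hlt⟩ := hζ
      have hgap : Tendsto (fun T : ℕ => √(T : ℝ) * (ζ j - ζ i)) atTop atTop :=
        (Real.tendsto_sqrt_atTop.comp tendsto_natCast_atTop_atTop).atTop_mul_const
          (sub_pos.2 hlt)
      filter_upwards [hgap.eventually_gt_atTop 1] with T hT
      rw [hlw, if_neg]
      intro hanti
      have h1 : ⌊√(T : ℝ) * ζ j + p * t * T⌋ ≤ ⌊√(T : ℝ) * ζ i + p * t * T⌋ := hanti hij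
      have h2 := Int.floor_le (√(T : ℝ) * ζ i + p * t * T)
      have h3 := Int.lt_floor_add_one (√(T : ℝ) * ζ j + p * t * T)
      have h4 : ((⌊√(T : ℝ) * ζ j + p * t * T⌋ : ℤ) : ℝ) ≤ ⌊√(T : ℝ) * ζ i + p * t * T⌋ := by
        exact_mod_cast h1
      linarith
  · filter_upwards [hABle] with T hT ζ
    rw [hlw]
    split_ifs
    · exact hT ζ
    · rw [abs_zero]
      exact (abs_nonneg _).trans (hT ζ)

/-- Weak convergence at the integer time `⌊t T⌋`. The total mass of the weights converges to a
nonzero number, so that non-crossing collections exist for large `T`. -/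
theorem tendsto_integral_rescaledAtObsTime {k : ℕ} {p t : ℝ} (hp : p ∈ Set.Ioo (0 : ℝ) 1)
    (ht : t ∈ Set.Ioo (0 : ℝ) 1) {a b : Fin k → ℝ} {x y : ℕ → Fin k → ℤ}
    (hx : ∀ T, Antitone (x T)) (hy : ∀ T, Antitone (y T))
    (hxa : ∀ i, Tendsto (fun T : ℕ => (x T i : ℝ) / √(T : ℝ)) atTop (𝓝 (a i)))
    (hyb : ∀ i, Tendsto (fun T : ℕ => ((y T i : ℝ) - p * T) / √(T : ℝ)) atTop (𝓝 (b i))) :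
    IntegrableOn (unnormalizedDensity p t a b) (weylChamber k) ∧
    (∀ᶠ T : ℕ in atTop, (avoidingFinset T (x T) (y T)).Nonempty) ∧
    ∀ f : (Fin k → ℝ) →ᵇ ℝ,
      Tendsto (fun T : ℕ => ∫ L, f (rescaledAtObsTime p t L) ∂(avoidingLaw T (x T) (y T))) atTop
        (𝓝 (∫ z, f z * density p t a b z)) := by
  obtain ⟨κ, hκ, hint, D, hlim, hbd⟩ := tendsto_latticeWeight hp ht hx hy hxa hyb
  have hmeas := (isClosed_weylChamber k).measurableSet
  have hZ := (density_properties hp ht a b hint.integrableOn).1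
  set u : ℕ → (Fin k → ℤ) → Fin k → ℝ := fun T z i => ((z i : ℝ) - p * t * T) / √(T : ℝ) with hu
  have hulim : ∀ ζ : Fin k → ℝ,
      Tendsto (fun T : ℕ => u T (latticePoint (√(T : ℝ)) (p * t * T) ζ)) atTop (𝓝 ζ) := by
    intro ζ
    refine tendsto_pi_nhds.2 fun j => ?_
    rw [tendsto_iff_dist_tendsto_zero]
    refine squeeze_zero' (Eventually.of_forall fun _ => dist_nonneg) ?_
      (tendsto_const_div_sqrt 1)
    filter_upwards [eventually_ge_atTop 1] with T hT
    have hr : 0 < √(T : ℝ) := Real.sqrt_pos.2 (by exact_mod_cast hT)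
    have h1 : u T (latticePoint (√(T : ℝ)) (p * t * T) ζ) j - ζ j =
        ((⌊√(T : ℝ) * ζ j + p * t * T⌋ : ℤ) - p * t * T - √(T : ℝ) * ζ j) / √(T : ℝ) := by
      simp only [hu, latticePoint]; field_simp
    rw [Real.dist_eq, h1, abs_div, abs_of_pos hr]
    gcongr
    have h4 := Int.floor_le (√(T : ℝ) * ζ j + p * t * T)
    have h5 := Int.lt_floor_add_one (√(T : ℝ) * ζ j + p * t * T)
    rw [abs_le]
    constructor <;> linarith
  have hDCT : ∀ f : (Fin k → ℝ) →ᵇ ℝ, Tendsto (fun T : ℕ => ∫ ζ,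
      latticeWeight a b p (obsTime t T) T (x T) (y T) (latticePoint (√(T : ℝ)) (p * t * T) ζ) *
        f (u T (latticePoint (√(T : ℝ)) (p * t * T) ζ))) atTop
      (𝓝 (∫ ζ, (κ * (weylChamber k).indicator (unnormalizedDensity p t a b) ζ) * f ζ)) := by
    intro f
    refine tendsto_integral_filter_of_dominated_convergence
      (fun ζ => (D * ∏ j, Real.exp (-|ζ j|)) * ‖f‖) (Eventually.of_forall fun T => ?_) ?_
      (((integrable_prod_exp_neg_abs k).const_mul D).mul_const _) (ae_of_all _ fun ζ => ?_)
    · exact ((measurable_of_countable fun z => latticeWeight a b p (obsTime t T) T (x T) (y T) z *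
        f (u T z)).comp (measurable_latticePoint _ _)).aestronglyMeasurable
    · filter_upwards [hbd] with T hT
      refine ae_of_all _ fun ζ => ?_
      rw [norm_mul]
      exact mul_le_mul (hT ζ) (f.norm_coe_le_norm _) (norm_nonneg _)
        ((abs_nonneg _).trans (hT ζ))
    · exact (hlim ζ).mul ((f.continuous.tendsto ζ).comp (hulim ζ))
  have hone := hDCT (BoundedContinuousFunction.const _ 1)
  simp only [BoundedContinuousFunction.const_apply, mul_one] at hone
  rw [integral_const_mul, integral_indicator hmeas] at hone
  have hden : κ * normalization p t a b ≠ 0 := mul_ne_zero hκ hZ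
  refine ⟨hint.integrableOn, ?_, fun f => ?_⟩
  · filter_upwards [hone.eventually_ne hden, eventually_ge_atTop 1] with T hT hT1
    exact (integral_position_eq a b hp (obsTime_le t T) hT1 (hx T) (hy T) (p * t * T)
      fun _ => 0).1 hT
  · refine (((hDCT f).div hone hden).congr' ?_).trans (le_of_eq ?_)
    · filter_upwards [eventually_ge_atTop 1] with T hT1
      exact ((integral_position_eq a b hp (obsTime_le t T) hT1 (hx T) (hy T) (p * t * T)
        fun z => f (u T z)).2).symm
    · congr 1
      rw [← integral_div]
      refine integral_congr_ae (ae_of_all _ fun ζ => ?_)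
      simp only [density, indicator_openWeylChamber_eq]
      change _ / (κ * normalization p t a b) = _
      field_simp

/-- The rescaled interpolated positions differ from those at time `⌊t T⌋` by at most one
increment. -/
lemma dist_rescaledPositions_le {k T : ℕ} {p t : ℝ} (ht : t ∈ Set.Ioo (0 : ℝ) 1)
    {x y : Fin k → ℤ} {L : Fin k → Fin (T + 1) → ℤ} (hL : L ∈ avoidingFinset T x y) :
    dist (rescaledPositions p t L) (rescaledAtObsTime p t L) ≤ 1 / √(T : ℝ) := by
  refine (dist_pi_le_iff (by positivity)).2 fun i => ?_
  have hstep := ((mem_avoidingFinset.1 hL).1 i).2.2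
  have h0 : 0 ≤ t * T := mul_nonneg ht.1.le (Nat.cast_nonneg T)
  have h1 := Nat.floor_le h0
  have h2 := Nat.lt_floor_add_one (t * T)
  set m := ⌊t * T⌋₊ with hm
  have hincr : |(L i ⟨min (m + 1) T, by omega⟩ : ℝ) - L i ⟨min m T, by omega⟩| ≤ 1 := by
    by_cases hmT : m < T
    · have h3 := hstep ⟨m, hmT⟩
      simp only [Fin.succ_mk, Fin.castSucc_mk] at h3
      simp only [min_eq_left (Nat.succ_le_of_lt hmT), min_eq_left hmT.le]
      rcases h3 with h3 | h3
      · rw [← Int.cast_sub, h3]; simp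
      · rw [← Int.cast_sub, h3]; simp
    · simp only [min_eq_right (not_lt.1 hmT), min_eq_right ((not_lt.1 hmT).trans m.le_succ)]
      simp
  have h3 : rescaledPositions p t L i - rescaledAtObsTime p t L i =
      ((t * T - m) * ((L i ⟨min (m + 1) T, by omega⟩ : ℝ) - L i ⟨min m T, by omega⟩)) /
        √(T : ℝ) := by
    simp only [rescaledPositions, rescaledAtObsTime, interpolate, obsTime, ← hm]
    ring
  rw [Real.dist_eq, h3, abs_div, abs_of_nonneg (Real.sqrt_nonneg _)]
  gcongr
  rw [abs_mul]
  refine mul_le_one₀ ?_ (abs_nonneg _) hincr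
  rw [abs_le]
  constructor <;> linarith

lemma isProbabilityMeasure_avoidingLaw {k T : ℕ} {x y : Fin k → ℤ}
    (h : (avoidingFinset T x y).Nonempty) : IsProbabilityMeasure (avoidingLaw T x y) := by
  rw [avoidingLaw_eq_uniformOn]
  refine isProbabilityMeasure_uniformOn (avoidingPaths_finite T x y) ?_
  simpa [avoidingFinset] using h

lemma abs_integral_sub_integral_le {k T : ℕ} {p t : ℝ} (ht : t ∈ Set.Ioo (0 : ℝ) 1)
    {x y : Fin k → ℤ} (h : (avoidingFinset T x y).Nonempty) {f : (Fin k → ℝ) → ℝ} {K : NNReal}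
    (hf : LipschitzWith K f) :
    |∫ L, f (rescaledPositions p t L) ∂(avoidingLaw T x y) -
      ∫ L, f (rescaledAtObsTime p t L) ∂(avoidingLaw T x y)| ≤ K / √(T : ℝ) := by
  have hcard : (0 : ℝ) < (avoidingFinset T x y).card := by exact_mod_cast h.card_pos
  rw [integral_avoidingLaw, integral_avoidingLaw, ← sub_div, ← Finset.sum_sub_distrib, abs_div,
    abs_of_pos hcard, div_le_iff₀ hcard]
  refine (Finset.abs_sum_le_sum_abs _ _).trans ?_
  rw [mul_comm, ← nsmul_eq_mul]
  refine Finset.sum_le_card_nsmul _ _ _ fun L hL => ?_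
  rw [← Real.dist_eq]
  refine (hf.dist_le_mul _ _).trans ?_
  have := mul_le_mul_of_nonneg_left (dist_rescaledPositions_le (p := p) ht hL) K.coe_nonneg
  rwa [mul_one_div] at this

lemma measurable_density {k : ℕ} (p t : ℝ) (a b : Fin k → ℝ) : Measurable (density p t a b) := by
  unfold density
  exact ((continuous_unnormalizedDensity p t a b).measurable.indicator
    (isOpen_openWeylChamber k).measurableSet).const_mul _

end NoncrossingBridges

theorem proposition3p9 (k : ℕ) (p t : ℝ) (hp : p ∈ Set.Ioo (0 : ℝ) 1) (ht : t ∈ Set.Ioo (0 : ℝ) 1)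
    (a b : Fin k → ℝ) (ha : a ∈ weylChamber k) (hb : b ∈ weylChamber k)
    (x y : ℕ → Fin k → ℤ) (hx : ∀ T, x T ∈ signatures k) (hy : ∀ T, y T ∈ signatures k)
    (hxa : ∀ i, Tendsto (fun T : ℕ => (x T i : ℝ) / √(T : ℝ)) atTop (𝓝 (a i)))
    (hyb : ∀ i, Tendsto (fun T : ℕ => ((y T i : ℝ) - p * T) / √(T : ℝ)) atTop (𝓝 (b i))) :
    -- the function `ρ` is well defined and is a probability density ...
    IntegrableOn (unnormalizedDensity p t a b) (weylChamber k) ∧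
    normalization p t a b ≠ 0 ∧
    (∀ z, 0 ≤ density p t a b z) ∧
    (∫ z, density p t a b z) = 1 ∧
    -- ... whose set of non-zeros is the open Weyl chamber,
    Function.support (density p t a b) = openWeylChamber k ∧
    -- the laws of the non-crossing bridges are well defined for all large `T`,
    (∀ᶠ T : ℕ in atTop, IsProbabilityMeasure (avoidingLaw T (x T) (y T))) ∧
    -- and `Z^T` converges weakly to the probability measure with density `ρ`
    ∀ f : (Fin k → ℝ) →ᵇ ℝ,
      Tendsto (fun T : ℕ => ∫ L, f (rescaledPositions p t L) ∂(avoidingLaw T (x T) (y T))) atTop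
        (𝓝 (∫ z, f z * density p t a b z)) := by
  obtain ⟨hint, hne, hconv⟩ := tendsto_integral_rescaledAtObsTime hp ht hx hy hxa hyb
  obtain ⟨hZ, hnonneg, hone, hsupp⟩ := density_properties hp ht a b hint
  refine ⟨hint, hZ, hnonneg, hone, hsupp,
    hne.mono fun T hT => isProbabilityMeasure_avoidingLaw hT, fun f => ?_⟩
  have hdens := measurable_density p t a b
  have hdint : Integrable (density p t a b) := by
    by_contra h
    rw [integral_undef h] at hone
    exact zero_ne_one hone
  set ν : Measure (Fin k → ℝ) := volume.withDensity fun z => ENNReal.ofReal (density p t a b z)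
    with hν
  have hνprob : IsProbabilityMeasure ν := by
    refine ⟨?_⟩
    rw [hν, withDensity_apply _ MeasurableSet.univ, Measure.restrict_univ,
      ← ofReal_integral_eq_lintegral_ofReal hdint (ae_of_all _ hnonneg), hone, ENNReal.ofReal_one]
  have hνint : ∀ g : (Fin k → ℝ) → ℝ, ∫ z, g z ∂ν = ∫ z, g z * density p t a b z := by
    intro g
    rw [hν, integral_withDensity_eq_integral_toReal_smul hdens.ennreal_ofReal
      (ae_of_all _ fun _ => ENNReal.ofReal_lt_top)]
    refine integral_congr_ae (ae_of_all _ fun z => ?_)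
    simp only [ENNReal.toReal_ofReal (hnonneg z), smul_eq_mul, mul_comm]
  have hmeas : ∀ T : ℕ, Measurable (rescaledPositions p t :
      (Fin k → Fin (T + 1) → ℤ) → Fin k → ℝ) := fun T => measurable_of_countable _
  classical
  -- for the finitely many `T` without non-crossing collections any probability measure will do
  set μ : ℕ → ProbabilityMeasure (Fin k → ℝ) := fun T =>
    if h : (avoidingFinset T (x T) (y T)).Nonempty then
      ⟨(avoidingLaw T (x T) (y T)).map (rescaledPositions p t),
        have := isProbabilityMeasure_avoidingLaw h
        Measure.isProbabilityMeasure_map (hmeas T).aemeasurable⟩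
    else ⟨ν, hνprob⟩ with hμ
  have hμint : ∀ g : (Fin k → ℝ) → ℝ, Continuous g → ∀ᶠ T in atTop,
      ∫ z, g z ∂(μ T : Measure (Fin k → ℝ)) =
        ∫ L, g (rescaledPositions p t L) ∂(avoidingLaw T (x T) (y T)) := by
    intro g hg
    filter_upwards [hne] with T hT
    have hμT : (μ T : Measure (Fin k → ℝ)) =
        (avoidingLaw T (x T) (y T)).map (rescaledPositions p t) :=
      congrArg Subtype.val (dif_pos hT)
    rw [hμT]
    exact integral_map (hmeas T).aemeasurable hg.aestronglyMeasurable
  have hweak : Tendsto μ atTop (𝓝 ⟨ν, hνprob⟩) := by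
    refine tendsto_iff_forall_lipschitz_integral_tendsto.2 fun g hgb ⟨K, hgK⟩ => ?_
    have h1 := hconv ⟨⟨g, hgK.continuous⟩, hgb⟩
    have h2 : Tendsto (fun T => ∫ L, g (rescaledPositions p t L) ∂(avoidingLaw T (x T) (y T)) -
        ∫ L, g (rescaledAtObsTime p t L) ∂(avoidingLaw T (x T) (y T))) atTop (𝓝 0) := by
      refine squeeze_zero_norm' ?_ (tendsto_const_div_sqrt K)
      filter_upwards [hne] with T hT using abs_integral_sub_integral_le ht hT hgK
    have h3 := h2.add h1
    rw [zero_add] at h3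
    refine (h3.congr' ?_).trans (le_of_eq ?_)
    · filter_upwards [hμint g hgK.continuous] with T hT
      rw [hT]
      exact sub_add_cancel _ _
    · congr 1
      exact (hνint g).symm
  have h := (ProbabilityMeasure.tendsto_iff_forall_integral_tendsto.1 hweak) f
  refine (h.congr' (hμint f f.continuous)).trans (le_of_eq ?_)
  congr 1
  exact hνint f
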